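/- Let $\Gamma\subset\mathrm{PSL}_2(\mathbb R)$ be a Fuchsian group of the first kind (a discrete subgroup such that $M=\Gamma\backslash\mathbb H$ has finite hyperbolic volume), and let $d_{\mathrm{hyp}}$ be the hyperbolic distance on the upper half-plane $\mathbb H$ and $u(z,w)=\frac{|z-w|^2}{4\,\mathrm{Im}(z)\,\mathrm{Im}(w)}$. Let $k(z,w)=k(u(z,w))$ be a point-pair invariant with automorphic kernel $K(z,w)=\sum_{\eta\in\Gamma}k(u(z,\eta w))$. Suppose that its Selberg/Harish-Chandra transform exists, i.e. that the integrals $$Q(v)=\int_v^\infty\frac{k(u)}{\sqrt{u-v}}\,du\ (v>0),\qquad g(u)=2\,Q\bigl(\sinh^2(u/2)\bigr),\qquad h(r)=\int_{-\infty}^\infty g(u)e^{iru}\,du\ (r\in\mathbb R)$$ converge absolutely, and that for some $\varepsilon>0$ the function $h$ extends to the strip $|\mathrm{Im}(r)|\le\frac12+\varepsilon$ so that there (S1) $h$ is even, (S2) $h$ is holomorphic, and $h(r)=O\bigl((1+|r|)^{-2}\bigr)$ as $r\to\infty$ in the strip. Assume furthermore that, for all $z,w\in\mathbb H$ with distinct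 images in $M$, $$K(z,w)=\frac1{4\pi}\sum_{\eta\in\Gamma}\int_{-\infty}^\infty r\tanh(\pi r)\,h(r)\,P_{-\frac12+ir}\bigl(\cosh d_{\mathrm{hyp}}(z,\eta w)\bigr)\,dr,$$ where $P_\nu$ is the Legendre function of the first kind. Then, for every $\delta$ with $0<\delta<\frac12$ and $\delta\le\varepsilon$, and all $z,w\in\mathbb H$ with distinct images in $M$, $$K(z,w)=\frac{1}{2\pi^{3/2}\,i}\int_{\mathrm{Re}(\nu)=1+\delta}\frac{2^{-\nu}\,\Gamma(\nu)}{\Gamma(\nu-\frac12)}\,h\Bigl(i\Bigl(\frac12-\nu\Bigr)\Bigr)\,\mathcal K_\nu(z,w)\,d\nu,$$ where $$\mathcal K_\nu(z,w)=\sum_{k=0}^\infty\frac{b_k(\nu)}{k!}K_{\nu+2k}(z,w),\qquad b_k(\nu)=\frac{(\frac{\nu}{2})_k(\frac{\nu+1}{2})_k}{(\nu+\frac12)_k},\qquad K_s(z,w)=\sum_{\eta\in\Gamma}\cosh\bigl(d_{\mathrm{hyp}}(z,\eta w)\bigr)^{-s},$$ $(a)_k=a(a+1)\cdots(a+k-1)$,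 and the integral and, for $\mathrm{Re}(\nu)=1+\delta$, the series defining $K_{\nu+2k}(z,w)$ and $\mathcal K_\nu(z,w)$ converge absolutely. -/

import Mathlib

noncomputable section

namespace HypKernel

open MeasureTheory
open Complex (I)
open scoped MatrixGroups UpperHalfPlane

/-! ### The hyperbolic surface -/

/-- The group `PSL₂(ℝ)`, with the quotient topology. -/
abbrev PSL2R : Type := Matrix.ProjectiveSpecialLinearGroup (Fin 2) ℝ

theorem smul_eq_of_mem_center (g : SL(2, ℝ)) (hg : g ∈ Subgroup.center SL(2, ℝ)) (z : ℍ) :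
    g • z = z := by
  obtain ⟨r, hr, hrg⟩ := Matrix.SpecialLinearGroup.mem_center_iff.mp hg
  have hr0 : (r : ℂ) ≠ 0 := by
    rintro h0
    have : r = 0 := by exact_mod_cast h0
    simp [this] at hr
  ext1
  rw [UpperHalfPlane.coe_specialLinearGroup_apply]
  simp [← hrg, hr0]

/-- The action of `PSL₂(ℝ)` on `ℍ` by fractional linear transformations, as a homomorphism. -/
def pslToPerm : PSL2R →* Equiv.Perm ℍ :=
  QuotientGroup.lift _ (MulAction.toPermHom SL(2, ℝ) ℍ) fun g hg =>
    Equiv.ext fun z => smul_eq_of_mem_center g hg z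

/-- `PSL₂(ℝ)` acts on the upper half-plane by fractional linear transformations. -/
instance : MulAction PSL2R ℍ := MulAction.compHom ℍ pslToPerm

theorem coe_smul_eq (g : SL(2, ℝ)) (z : ℍ) : (QuotientGroup.mk g : PSL2R) • z = g • z := rfl

/-- Fuchsian groups of the first kind: discrete subgroups `Γ` of `PSL₂(ℝ)` such that `Γ \ ℍ` has
finite hyperbolic volume (`volume` on `ℍ` is `dx dy / y ^ 2`). -/
structure IsFuchsianFirstKind (Γ : Subgroup PSL2R) : Prop where
  discrete : DiscreteTopology Γ
  finite_volume : ∃ F : Set ℍ, IsFundamentalDomain Γ F ∧ volume F < ⊤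

/-- The surface `M = Γ \ ℍ`. -/
abbrev Surface (Γ : Subgroup PSL2R) : Type := MulAction.orbitRel.Quotient Γ ℍ

/-- The natural projection `ℍ → M`. -/
def proj (Γ : Subgroup PSL2R) (z : ℍ) : Surface Γ := Quotient.mk _ z

/-- The displacement `u(z, w) = |z - w|² / (4 Im z Im w)`. -/
def u (z w : ℍ) : ℝ := ‖(z : ℂ) - w‖ ^ 2 / (4 * z.im * w.im)

/-- The automorphic kernel `K(z, w) = ∑_{η ∈ Γ} k(u(z, η w))` of the point-pair invariant
`(z, w) ↦ k(u(z, w))`. -/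
def automorphicKernel (Γ : Subgroup PSL2R) (k : ℝ → ℂ) (z w : ℍ) : ℂ :=
  ∑' η : Γ, k (u z (η • w))

/-! ### The Selberg/Harish-Chandra transform -/

/-- `Q(v) = ∫_v^∞ k(u) (u - v)^{-1/2} du`. -/
def selbergQ (k : ℝ → ℂ) (v : ℝ) : ℂ := ∫ u in Set.Ioi v, k u / (√(u - v) : ℂ)

/-- `g(u) = 2 Q(sinh²(u/2))`. -/
def selbergG (k : ℝ → ℂ) (u : ℝ) : ℂ := 2 * selbergQ k (Real.sinh (u / 2) ^ 2)

/-- The Selberg/Harish-Chandra transform of `k` exists and is given on the real line by `h`, i.e.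
`h(r) = ∫ g(u) e^{iru} du`. Since `h` is a function on `ℂ`, its values off the real line are pinned
down by a holomorphy assumption on a strip. -/
structure HasSelbergTransform (k : ℝ → ℂ) (h : ℂ → ℂ) : Prop where
  integrableOn_Q : ∀ v > 0, IntegrableOn (fun u : ℝ => k u / (√(u - v) : ℂ)) (Set.Ioi v)
  integrable_g : Integrable (selbergG k)
  eq_integral : ∀ r : ℝ, h r = ∫ u : ℝ, selbergG k u * Complex.exp (I * r * u)

/-- The closed strip `|Im r| ≤ 1/2 + ε`. -/
def strip (ε : ℝ) : Set ℂ := {r | |r.im| ≤ 1 / 2 + ε}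

/-! ### The Legendre function -/

/-- The Legendre function of the first kind `P_ν(x)`, for real `x ≥ 1` and complex degree `ν`,
by Laplace's integral
`P_ν(x) = π⁻¹ ∫_0^π (x + √(x² - 1) cos φ)^ν dφ` (the base of the power is positive). -/
def legendreP (ν : ℂ) (x : ℝ) : ℂ :=
  (Real.pi : ℂ)⁻¹ * ∫ φ in (0 : ℝ)..Real.pi, ((x + √(x ^ 2 - 1) * Real.cos φ : ℝ) : ℂ) ^ ν

/-- `(4π)⁻¹ ∑_{η ∈ Γ} ∫ r tanh(πr) h(r) P_{-1/2 + ir}(cosh d(z, η w)) dr`. -/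
def mehlerFockKernel (Γ : Subgroup PSL2R) (h : ℂ → ℂ) (z w : ℍ) : ℂ :=
  1 / (4 * Real.pi) * ∑' η : Γ, ∫ r : ℝ, (r * Real.tanh (Real.pi * r) : ℂ) * h r *
    legendreP (-1 / 2 + I * r) (Real.cosh (dist z (η • w)))

/-! ### The kernels `K_s` and `𝒦_ν` -/

/-- The term `cosh(d(z, η w))^{-s}`. -/
def coshTerm (Γ : Subgroup PSL2R) (s : ℂ) (z w : ℍ) (η : Γ) : ℂ :=
  (Real.cosh (dist z (η • w)) : ℂ) ^ (-s)

/-- `K_s(z, w) = ∑_{η ∈ Γ} cosh(d(z, η w))^{-s}`. -/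
def coshKernel (Γ : Subgroup PSL2R) (s : ℂ) (z w : ℍ) : ℂ := ∑' η : Γ, coshTerm Γ s z w η

/-- The Pochhammer symbol `(a)_k = a (a + 1) ⋯ (a + k - 1)`. -/
def poch (a : ℂ) (k : ℕ) : ℂ := (ascPochhammer ℂ k).eval a

/-- `b_k(ν) = (ν/2)_k ((ν+1)/2)_k / (ν+1/2)_k`. -/
def b (k : ℕ) (ν : ℂ) : ℂ := poch (ν / 2) k * poch ((ν + 1) / 2) k / poch (ν + 1 / 2) k

/-- The term `b_k(ν) / k! · K_{ν+2k}(z, w)`. -/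
def calKTerm (Γ : Subgroup PSL2R) (ν : ℂ) (z w : ℍ) (k : ℕ) : ℂ :=
  b k ν / (Nat.factorial k : ℂ) * coshKernel Γ (ν + 2 * k) z w

/-- `𝒦_ν(z, w) = ∑_{k ≥ 0} b_k(ν) / k! · K_{ν+2k}(z, w)`. -/
def calK (Γ : Subgroup PSL2R) (ν : ℂ) (z w : ℍ) : ℂ := ∑' k : ℕ, calKTerm Γ ν z w k

/-- The integrand `2^{-ν} Γ(ν) / Γ(ν - 1/2) · h(i(1/2 - ν)) · 𝒦_ν(z, w)`. -/
def integrand (Γ : Subgroup PSL2R) (h : ℂ → ℂ) (z w : ℍ) (ν : ℂ) : ℂ :=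
  (2 : ℂ) ^ (-ν) * Complex.Gamma ν / Complex.Gamma (ν - 1 / 2) * h (I * (1 / 2 - ν)) *
    calK Γ ν z w

/-- Absolute convergence of the integral of `f` along the line `Re ν = σ`. -/
def VerticalIntegrable (f : ℂ → ℂ) (σ : ℝ) : Prop := Integrable fun t : ℝ => f (σ + t * I)

/-- The integral `∫_{Re ν = σ} f(ν) dν` along the vertical line, oriented upwards. -/
def verticalIntegral (f : ℂ → ℂ) (σ : ℝ) : ℂ := I * ∫ t : ℝ, f (σ + t * I)

end HypKernel

end

namespace HypKernel

open MeasureTheory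
open scoped MatrixGroups UpperHalfPlane

/-! ### Convergence of `K_s` for `Re s > 1` -/

/-! For a fixed `η` put `x = cosh d(z, η w)` and `a = e^{-d(z, η w)}`, so that `x = (a + a⁻¹) / 2`.
The engine is the Legendre function of the second kind, `legendreQ a μ = Q_{μ-1}(x)`. The connection
formula `Q_{-1/2-ir} - Q_{-1/2+ir} = iπ tanh(πr) P_{-1/2+ir}` (`legendreQ_sub_legendreQ`) and the
evenness of `h` turn each Mehler–Fock integral into `(2i/π) ∫ r h(r) Q_{-1/2+ir}(x) dr`.

The gain is that `Q_{μ-1}(x)` is holomorphic for `Re μ > 0` and, on `Re μ ≥ σ > 0` and `a ≤ a₀ < 1`,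
is `O(a^{Re μ} |μ|^{-1/2})` (`exists_norm_legendreQ_le`). With `h(r) = O((1 + |r|)^{-2})` the
integrand is `O((1 + |Re r|)^{-3/2})`, so the line `Im r = 0` moves down to `Im r = -(1/2 + δ)`
without meeting a pole. There `ν = 1/2 + ir` has real part `1 + δ`, and the terms are `O(a^{1+δ})`,
which is summable over `Γ` (`summable_cosh_rpow`). Sum and integral can then be exchanged.

It remains to expand `Q_{ν-1}(x)` in powers of `x⁻¹`: it is `2^{-ν} Γ(ν) Γ(1/2) / Γ(ν + 1/2)` times
`∑ b_k(ν) / k! · x^{-ν-2k}` (`hasSum_legendreQ`), so that summing over `η` produces `𝒦_ν`. The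
factor `r` is absorbed by `Γ(ν + 1/2) = (ν - 1/2) Γ(ν - 1/2)`, because `ν - 1/2 = ir`.

Both expansions of `Q` come from the integral defining `legendreQ`. A rescaling gives a series in
`a²`, which yields holomorphy and the bounds; a two-to-one quadratic substitution gives the integral
of `(1 - t²)^{μ-1} (x - t)^{-μ}` over `(-1, 1)`, which yields the series in `x⁻¹`. The connection
formula is Cauchy's theorem in the upper half-plane for `w^ν ((w - a)(w - a⁻¹))^{-1/2}`. -/

theorem countable_of_discreteTopology (Γ : Subgroup PSL2R) [DiscreteTopology Γ] : Countable Γ := by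
  have : SecondCountableTopology (Matrix (Fin 2) (Fin 2) ℝ) :=
    inferInstanceAs (SecondCountableTopology (Fin 2 → Fin 2 → ℝ))
  have : SecondCountableTopology SL(2, ℝ) :=
    (Topology.IsEmbedding.subtypeVal
      (p := fun A : Matrix (Fin 2) (Fin 2) ℝ => A.det = 1)).secondCountableTopology
  have : SecondCountableTopology PSL2R := QuotientGroup.instSecondCountableTopology _
  exact countable_of_Lindelof_of_discrete

theorem exists_smul_eq (g : PSL2R) : ∃ g' : SL(2, ℝ), ∀ z : ℍ, g • z = g' • z := by
  obtain ⟨g', rfl⟩ := QuotientGroup.mk_surjective g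
  exact ⟨g', fun z => rfl⟩

instance (Γ : Subgroup PSL2R) : IsIsometricSMul Γ ℍ where
  isometry_smul η := by
    obtain ⟨g, hg⟩ := exists_smul_eq η
    have : (fun z : ℍ => η • z) = fun z => g • z := funext hg
    rw [this]
    exact isometry_smul ℍ g

instance (Γ : Subgroup PSL2R) : MeasurableConstSMul Γ ℍ where
  measurable_const_smul η := (isometry_smul ℍ η).continuous.measurable

instance (Γ : Subgroup PSL2R) : SMulInvariantMeasure Γ ℍ volume where
  measure_preimage_smul η s _ := by
    obtain ⟨g, hg⟩ := exists_smul_eq η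
    have : (fun z : ℍ => η • z) = fun z => (g : GL (Fin 2) ℝ) • z := funext hg
    rw [this]
    exact measure_preimage_smul volume _ s

theorem integrableOn_rpow_mul_one_add_sq_rpow {s : ℝ} (hs : 1 < s) :
    IntegrableOn (fun y : ℝ => y ^ (s - 2) * (1 + y ^ 2) ^ (-s / 2)) (Set.Ioi 0) := by
  have hm : Measurable fun y : ℝ => y ^ (s - 2) * (1 + y ^ 2) ^ (-s / 2) := by fun_prop
  rw [← Set.Ioc_union_Ioi_eq_Ioi zero_le_one, integrableOn_union]
  constructor
  · have h1 : IntegrableOn (fun y : ℝ => y ^ (s - 2)) (Set.Ioc 0 1) := by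
      rw [integrableOn_Ioc_iff_integrableOn_Ioo,
        intervalIntegral.integrableOn_Ioo_rpow_iff one_pos]
      linarith
    refine h1.mono' hm.aestronglyMeasurable ?_
    filter_upwards [ae_restrict_mem measurableSet_Ioc] with y hy
    have hy0 : 0 ≤ y ^ (s - 2) := Real.rpow_nonneg hy.1.le _
    have h2 : (1 + y ^ 2) ^ (-s / 2) ≤ 1 :=
      Real.rpow_le_one_of_one_le_of_nonpos (by nlinarith [sq_nonneg y]) (by linarith)
    rw [Real.norm_of_nonneg (by positivity)]
    exact mul_le_of_le_one_right hy0 h2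
  · have h1 : IntegrableOn (fun y : ℝ => y ^ (-2 : ℝ)) (Set.Ioi 1) :=
      integrableOn_Ioi_rpow_of_lt (by norm_num) one_pos
    refine h1.mono' hm.aestronglyMeasurable ?_
    filter_upwards [ae_restrict_mem measurableSet_Ioi] with y hy
    have hy0 : 0 < y := one_pos.trans hy
    have h2 : (1 + y ^ 2) ^ (-s / 2) ≤ y ^ (-s) := by
      calc (1 + y ^ 2) ^ (-s / 2) ≤ (y ^ 2) ^ (-s / 2) :=
            Real.rpow_le_rpow_of_nonpos (by positivity) (by linarith) (by linarith)
        _ = y ^ (-s) := by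
            rw [← Real.rpow_natCast, ← Real.rpow_mul hy0.le]
            congr 1
            push_cast
            ring
    rw [Real.norm_of_nonneg (by positivity)]
    calc y ^ (s - 2) * (1 + y ^ 2) ^ (-s / 2) ≤ y ^ (s - 2) * y ^ (-s) := by gcongr
      _ = y ^ (-2 : ℝ) := by rw [← Real.rpow_add hy0]; ring_nf

/-- Since `cosh d(i, x + iy) = (1 + x² + y²) / (2y)`, giving half of the exponent to each variable
bounds the integrand, density `y^{-2}` included, by a function of `x` times a function of `y`. -/
theorem cosh_dist_I_rpow_le {s : ℝ} (hs : 0 < s) (v : ℍ) :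
    (1 / v.im) ^ 2 * Real.cosh (dist UpperHalfPlane.I v) ^ (-s) ≤
      (2 ^ s * (1 + v.re ^ 2) ^ (-s / 2)) * (v.im ^ (s - 2) * (1 + v.im ^ 2) ^ (-s / 2)) := by
  have hy := v.im_pos
  set y := v.im
  set x := v.re
  have h1 : Real.cosh (dist UpperHalfPlane.I v) = (1 + x ^ 2 + y ^ 2) / (2 * y) := by
    rw [UpperHalfPlane.cosh_dist']
    simp [x, y]
    ring
  have h2 : ((1 + x ^ 2 + y ^ 2) / (2 * y)) ^ (-s) =
      2 ^ s * y ^ s * (1 + x ^ 2 + y ^ 2) ^ (-s) := by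
    rw [Real.div_rpow (by positivity) (by positivity), Real.mul_rpow (by norm_num) hy.le,
      Real.rpow_neg zero_le_two, Real.rpow_neg hy.le]
    field_simp
  have h3 : (1 + x ^ 2 + y ^ 2) ^ (-s) ≤ (1 + x ^ 2) ^ (-s / 2) * (1 + y ^ 2) ^ (-s / 2) := by
    have : (1 + x ^ 2 + y ^ 2) ^ (-s) =
        (1 + x ^ 2 + y ^ 2) ^ (-s / 2) * (1 + x ^ 2 + y ^ 2) ^ (-s / 2) := by
      rw [← Real.rpow_add (by positivity)]; ring_nf
    rw [this]
    have hx2 := sq_nonneg x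
    have hy2 := sq_nonneg y
    gcongr ?_ * ?_
    · exact Real.rpow_le_rpow_of_nonpos (by positivity) (by linarith) (by linarith)
    · exact Real.rpow_le_rpow_of_nonpos (by positivity) (by linarith) (by linarith)
  have h4 : y ^ (s - 2) = (1 / y) ^ 2 * y ^ s := by
    rw [Real.rpow_sub hy]
    norm_num
    field_simp
  rw [h1, h2, h4]
  calc (1 / y) ^ 2 * (2 ^ s * y ^ s * (1 + x ^ 2 + y ^ 2) ^ (-s))
      ≤ (1 / y) ^ 2 * (2 ^ s * y ^ s * ((1 + x ^ 2) ^ (-s / 2) * (1 + y ^ 2) ^ (-s / 2))) := by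
        gcongr
    _ = _ := by ring

theorem lintegral_cosh_dist_I_rpow_lt_top {s : ℝ} (hs : 1 < s) :
    ∫⁻ v : ℍ, ENNReal.ofReal (Real.cosh (dist UpperHalfPlane.I v) ^ (-s)) < ⊤ := by
  let A : ℝ → ENNReal := fun x => ENNReal.ofReal (2 ^ s * (1 + x ^ 2) ^ (-s / 2))
  let B : ℝ → ENNReal := (Set.Ioi 0).indicator
    fun y => ENNReal.ofReal (y ^ (s - 2) * (1 + y ^ 2) ^ (-s / 2))
  have hA : Measurable A := by unfold A; fun_prop
  have hB : Measurable B := Measurable.indicator (by fun_prop) measurableSet_Ioi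
  have hAi : ∫⁻ x, A x < ⊤ := by
    have : Integrable fun x : ℝ => 2 ^ s * (1 + x ^ 2) ^ (-s / 2) := by
      have := (integrable_rpow_neg_one_add_norm_sq (E := ℝ) (μ := volume) (r := s) (by simpa))
      simpa using this.const_mul (2 ^ s)
    exact this.lintegral_lt_top
  have hBi : ∫⁻ y, B y < ⊤ := by
    rw [lintegral_indicator measurableSet_Ioi]
    exact (integrableOn_rpow_mul_one_add_sq_rpow hs).lintegral_lt_top
  have hF : Measurable fun v : ℍ =>
      ENNReal.ofReal (Real.cosh (dist UpperHalfPlane.I v) ^ (-s)) := by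
    refine ENNReal.measurable_ofReal.comp (Measurable.pow_const ?_ _)
    exact (Real.continuous_cosh.comp (continuous_const.dist continuous_id)).measurable
  have hden : Measurable fun z : ℍ =>
      (((1 / NNReal.mk z.im z.im_pos.le : NNReal) ^ 2 : NNReal) : ENNReal) := by
    refine measurable_coe_nnreal_ennreal.comp (Measurable.pow_const (Measurable.div ?_ ?_) _)
    · exact measurable_const
    · exact (UpperHalfPlane.continuous_im.subtype_mk _).measurable
  rw [UpperHalfPlane.volume_def, lintegral_withDensity_eq_lintegral_mul _ hden hF]
  calc _ ≤ ∫⁻ v : ℍ, (fun c : ℂ => A c.re * B c.im) v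
          ∂(volume.comap UpperHalfPlane.coe) := by
        refine lintegral_mono fun v => ?_
        have h0 : (((1 / NNReal.mk v.im v.im_pos.le : NNReal) ^ 2 : NNReal) : ENNReal) =
            ENNReal.ofReal ((1 / v.im) ^ 2) := by
          rw [ENNReal.ofReal, ENNReal.coe_inj]
          ext
          rw [Real.coe_toNNReal _ (sq_nonneg _)]
          simp
        have hv : v.im ∈ Set.Ioi (0 : ℝ) := v.im_pos
        have hy := v.im_pos
        simp only [Pi.mul_apply, h0, A, B, UpperHalfPlane.coe_im, UpperHalfPlane.coe_re,
          Set.indicator_of_mem hv]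
        rw [← ENNReal.ofReal_mul (by positivity), ← ENNReal.ofReal_mul (by positivity)]
        exact ENNReal.ofReal_le_ofReal (cosh_dist_I_rpow_le (one_pos.trans hs) v)
    _ = ∫⁻ c in Set.range UpperHalfPlane.coe, A c.re * B c.im := by
        rw [← UpperHalfPlane.measurableEmbedding_coe.lintegral_map (fun c : ℂ => A c.re * B c.im),
          UpperHalfPlane.measurableEmbedding_coe.map_comap]
    _ ≤ ∫⁻ c : ℂ, A c.re * B c.im := setLIntegral_le_lintegral _ _
    _ = ∫⁻ p : ℝ × ℝ, A p.1 * B p.2 := by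
        rw [← Complex.volume_preserving_equiv_real_prod.lintegral_comp_emb
          Complex.measurableEquivRealProd.measurableEmbedding]
        rfl
    _ = (∫⁻ x, A x) * ∫⁻ y, B y := lintegral_prod_mul hA.aemeasurable hB.aemeasurable
    _ < ⊤ := ENNReal.mul_lt_top hAi hBi

theorem cosh_le_exp_mul_cosh {p q D : ℝ} (hp : 0 ≤ p) (hD : 0 ≤ D) (h : p ≤ q + D) :
    Real.cosh p ≤ Real.exp D * Real.cosh q := by
  have h1 : Real.cosh p ≤ Real.cosh (q + D) := by
    rw [Real.cosh_le_cosh, abs_of_nonneg hp]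
    exact h.trans (le_abs_self _)
  refine h1.trans ?_
  rw [Real.cosh_add, ← Real.cosh_add_sinh D, mul_comm, add_mul]
  have : Real.sinh q ≤ Real.cosh q := (Real.sinh_lt_cosh q).le
  have h2 : 0 ≤ Real.sinh D := Real.sinh_nonneg_iff.2 hD
  nlinarith

theorem volume_univ_ne_zero : (volume : Measure ℍ) Set.univ ≠ 0 := by
  have hden : Measurable fun z : ℍ =>
      (((1 / NNReal.mk z.im z.im_pos.le : NNReal) ^ 2 : NNReal) : ENNReal) := by
    refine measurable_coe_nnreal_ennreal.comp (Measurable.pow_const (Measurable.div ?_ ?_) _)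
    · exact measurable_const
    · exact (UpperHalfPlane.continuous_im.subtype_mk _).measurable
  intro h0
  have h1 : volume.comap UpperHalfPlane.coe ≪ (volume : Measure ℍ) := by
    rw [UpperHalfPlane.volume_def]
    refine withDensity_absolutelyContinuous' hden.aemeasurable (Filter.Eventually.of_forall ?_)
    intro v hv
    have := v.im_pos.ne'
    rw [ENNReal.coe_eq_zero, sq_eq_zero_iff, one_div, inv_eq_zero] at hv
    exact this (congrArg NNReal.toReal hv)
  have h2 := h1 h0
  rw [UpperHalfPlane.measurableEmbedding_coe.comap_apply, Set.image_univ] at h2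
  exact (UpperHalfPlane.isOpenEmbedding_coe.isOpen_range.measure_pos volume
    (Set.range_nonempty _)).ne' h2

/-- Unfolding: the integral over a fundamental domain of the sum over `Γ` is the integral of
`cosh(d(i, v))^{-s}` over `ℍ`, which is finite for `s > 1`. So the series converges at some point
`v`, and the triangle inequality carries this to every `z` and `w`. -/
theorem IsFuchsianFirstKind.summable_cosh_rpow {Γ : Subgroup PSL2R} (hΓ : IsFuchsianFirstKind Γ)
    {s : ℝ} (hs : 1 < s) (z w : ℍ) :
    Summable fun η : Γ => Real.cosh (dist z (η • w)) ^ (-s) := by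
  have := hΓ.discrete
  have := countable_of_discreteTopology Γ
  obtain ⟨F, hF, -⟩ := hΓ.finite_volume
  -- If `F` were null, its countably many translates would make all of `ℍ` null; a non-null `F` is
  -- what turns "almost everywhere" into "somewhere".
  have hF0 : volume F ≠ 0 := by
    intro h0
    have h1 := hF.measure_zero_of_invariant (t := Set.univ)
    exact volume_univ_ne_zero (h1 (by intro g; simp) (by simp [h0]))
  have key : ∑' η : Γ, ∫⁻ v in F,
      ENNReal.ofReal (Real.cosh (dist UpperHalfPlane.I (η • v)) ^ (-s)) < ⊤ := by
    rw [← hF.lintegral_eq_tsum'' fun v =>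
      ENNReal.ofReal (Real.cosh (dist UpperHalfPlane.I v) ^ (-s))]
    exact lintegral_cosh_dist_I_rpow_lt_top hs
  have hmeas (η : Γ) : Measurable fun v : ℍ =>
      ENNReal.ofReal (Real.cosh (dist UpperHalfPlane.I (η • v)) ^ (-s)) := by
    refine ENNReal.measurable_ofReal.comp (Measurable.pow_const ?_ _)
    exact (Real.continuous_cosh.comp
      (continuous_const.dist (isometry_smul ℍ η).continuous)).measurable
  rw [← lintegral_tsum fun η => (hmeas η).aemeasurable] at key
  have hae := ae_lt_top (Measurable.tsum hmeas) key.ne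
  have hne : (ae (volume.restrict F)).NeBot := by
    rw [ae_neBot]
    simpa [Measure.restrict_eq_zero] using hF0
  obtain ⟨v, hv⟩ := hae.exists
  have hsum : Summable fun η : Γ => Real.cosh (dist UpperHalfPlane.I (η • v)) ^ (-s) := by
    have := ENNReal.summable_toReal hv.ne
    refine this.congr fun η => ENNReal.toReal_ofReal ?_
    exact Real.rpow_nonneg (Real.cosh_pos _).le _
  -- Changing both base points moves each distance by at most `D`, hence costs at most the factor
  -- `e^{Ds}`.
  set D := dist UpperHalfPlane.I z + dist w v
  refine (hsum.mul_left (Real.exp D ^ s)).of_nonneg_of_le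
    (fun η => Real.rpow_nonneg (Real.cosh_pos _).le _) fun η => ?_
  have h1 : dist UpperHalfPlane.I (η • v) ≤ dist z (η • w) + D := by
    have h2 := dist_triangle4 UpperHalfPlane.I z (η • w) (η • v)
    rw [dist_smul] at h2
    simp only [D]
    linarith
  have h2 := cosh_le_exp_mul_cosh dist_nonneg (by positivity) h1
  have h3 := (Real.cosh_pos (dist UpperHalfPlane.I (η • v)))
  have h4 := (Real.cosh_pos (dist z (η • w)))
  have h5 : (Real.exp D * Real.cosh (dist z (η • w))) ^ (-s) ≤
      Real.cosh (dist UpperHalfPlane.I (η • v)) ^ (-s) :=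
    Real.rpow_le_rpow_of_nonpos h3 h2 (by linarith)
  rw [Real.mul_rpow (Real.exp_pos _).le h4.le, Real.rpow_neg (Real.exp_pos _).le] at h5
  rwa [inv_mul_le_iff₀ (by positivity)] at h5

/-! ### Gamma quotients and the binomial series -/

/-- From `(ν + 1/2 + n)² = (ν + n)(ν + 1 + n) + 1/4`, each factor is at most `1 + 1 / (4 (σ + n)(σ +
n + 1))` times the corresponding one, with `σ = Re ν`; these corrections telescope in the exponent.
-/
theorem prod_norm_add_half_sq_le {ν : ℂ} (hν : 0 < ν.re) (n : ℕ) :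
    ∏ j ∈ Finset.range n, ‖ν + 1 / 2 + j‖ ^ 2 ≤
      Real.exp (1 / 4 * (1 / ν.re - 1 / (ν.re + n))) *
        ∏ j ∈ Finset.range n, (‖ν + j‖ * ‖ν + 1 + j‖) := by
  induction n with
  | zero => simp
  | succ n ih =>
    have hn : (0 : ℝ) ≤ n := n.cast_nonneg
    have h0 : 0 < ν.re + n := by linarith
    have r1 : ν.re + n ≤ ‖ν + n‖ := by simpa using Complex.re_le_norm (ν + n)
    have r2 : ν.re + n + 1 ≤ ‖ν + 1 + n‖ := by
      have := Complex.re_le_norm (ν + 1 + n)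
      simp at this
      linarith
    have hfac : ‖ν + 1 / 2 + n‖ ^ 2 ≤
        Real.exp (1 / 4 * (1 / (ν.re + n) - 1 / (ν.re + (n + 1)))) *
          (‖ν + n‖ * ‖ν + 1 + n‖) := by
      have e : (ν + 1 / 2 + n) ^ 2 = (ν + n) * (ν + 1 + n) + 1 / 4 := by ring
      have hP : (ν.re + n) * (ν.re + n + 1) ≤ ‖ν + n‖ * ‖ν + 1 + n‖ := by gcongr
      have hq : 1 / 4 * (1 / (ν.re + n) - 1 / (ν.re + (n + 1))) =
          1 / 4 / ((ν.re + n) * (ν.re + n + 1)) := by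
        field_simp
        ring
      rw [← norm_pow, e, hq]
      set P := ‖ν + n‖ * ‖ν + 1 + n‖
      have hP0 : 0 < (ν.re + n) * (ν.re + n + 1) := by positivity
      calc ‖(ν + n) * (ν + 1 + n) + 1 / 4‖ ≤ P + 1 / 4 := by
            refine (norm_add_le _ _).trans ?_
            rw [norm_mul]
            norm_num [P]
        _ ≤ (1 / 4 / ((ν.re + n) * (ν.re + n + 1)) + 1) * P := by
            have : 1 / 4 ≤ 1 / 4 / ((ν.re + n) * (ν.re + n + 1)) * P := by
              rw [div_mul_eq_mul_div, le_div_iff₀ hP0]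
              gcongr
            linarith
        _ ≤ _ := by
            gcongr
            exact Real.add_one_le_exp _
    rw [Finset.prod_range_succ, Finset.prod_range_succ]
    calc _ ≤ (Real.exp (1 / 4 * (1 / ν.re - 1 / (ν.re + n))) *
          ∏ j ∈ Finset.range n, (‖ν + j‖ * ‖ν + 1 + j‖)) *
          (Real.exp (1 / 4 * (1 / (ν.re + n) - 1 / (ν.re + (n + 1)))) *
          (‖ν + n‖ * ‖ν + 1 + n‖)) := by gcongr
      _ = _ := by
        rw [mul_mul_mul_comm, ← Real.exp_add]
        push_cast
        ring_nf

/-- The product estimate passes to the limit in Gauss's formula and compares `Γ(ν) Γ(ν + 1) = ν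
Γ(ν)²` with `Γ(ν + 1/2)²`. This replaces Stirling's formula and is uniform in vertical direction. -/
theorem norm_Gamma_div_Gamma_add_half_sq_le {ν : ℂ} (hν : 0 < ν.re) :
    ‖Complex.Gamma ν / Complex.Gamma (ν + 1 / 2)‖ ^ 2 ≤
      Real.exp (1 / (4 * ν.re)) / ‖ν‖ := by
  have hν0 : ν ≠ 0 := by rintro rfl; simp at hν
  have hG : Complex.Gamma (ν + 1 / 2) ≠ 0 := by
    refine Complex.Gamma_ne_zero_of_re_pos ?_
    simp
    linarith
  have hseq (n : ℕ) (hn : n ≠ 0) : ‖Complex.GammaSeq ν n‖ * ‖Complex.GammaSeq (ν + 1) n‖ ≤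
      Real.exp (1 / (4 * ν.re)) * ‖Complex.GammaSeq (ν + 1 / 2) n‖ ^ 2 := by
    have hpr := prod_norm_add_half_sq_le hν (n + 1)
    have hn0 : (0 : ℝ) ≤ n := n.cast_nonneg
    have he : Real.exp (1 / 4 * (1 / ν.re - 1 / (ν.re + (n + 1 : ℕ)))) ≤
        Real.exp (1 / (4 * ν.re)) := by
      refine Real.exp_le_exp.2 ?_
      have : 0 ≤ 1 / (ν.re + (n + 1 : ℕ)) := by positivity
      have e : 1 / (4 * ν.re) = 1 / 4 * (1 / ν.re) := by field_simp
      rw [e]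
      linarith
    have hpos (c : ℂ) (hc : 0 < c.re) : 0 < ∏ j ∈ Finset.range (n + 1), ‖c + j‖ := by
      refine Finset.prod_pos fun j _ => norm_pos_iff.2 fun h => ?_
      have := congrArg Complex.re h
      simp at this
      have hj : (0 : ℝ) ≤ j := j.cast_nonneg
      linarith
    have p0 := hpos ν hν
    have p1 := hpos (ν + 1) (by simp; linarith)
    have p2 := hpos (ν + 1 / 2) (by simp; linarith)
    rw [Finset.prod_mul_distrib, Finset.prod_pow] at hpr
    simp only [Complex.GammaSeq, norm_div, norm_mul, norm_prod]
    have hpow : ‖(n : ℂ) ^ ν‖ * ‖(n : ℂ) ^ (ν + 1)‖ = ‖(n : ℂ) ^ (ν + 1 / 2)‖ ^ 2 := by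
      have : (n : ℂ) ≠ 0 := by exact_mod_cast hn
      rw [← norm_mul, ← norm_pow, ← Complex.cpow_add _ _ this, sq, ← Complex.cpow_add _ _ this]
      congr 2
      ring
    rw [div_mul_div_comm, div_pow, ← mul_div_assoc, div_le_div_iff₀ (by positivity) (by positivity),
      mul_mul_mul_comm, hpow, mul_pow]
    set A := ∏ j ∈ Finset.range (n + 1), ‖ν + j‖
    set B := ∏ j ∈ Finset.range (n + 1), ‖ν + 1 + j‖
    set C := ∏ j ∈ Finset.range (n + 1), ‖ν + 1 / 2 + j‖
    have h3 : C ^ 2 ≤ Real.exp (1 / (4 * ν.re)) * (A * B) := hpr.trans (by gcongr)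
    calc _ ≤ ‖(n : ℂ) ^ (ν + 1 / 2)‖ ^ 2 * (‖(n.factorial : ℂ)‖ * ‖(n.factorial : ℂ)‖) *
          (Real.exp (1 / (4 * ν.re)) * (A * B)) := by gcongr
      _ = _ := by ring
  have hlim := le_of_tendsto_of_tendsto
    ((Complex.GammaSeq_tendsto_Gamma ν).norm.mul (Complex.GammaSeq_tendsto_Gamma (ν + 1)).norm)
    (((Complex.GammaSeq_tendsto_Gamma (ν + 1 / 2)).norm.pow 2).const_mul _)
    (Filter.eventually_atTop.2 ⟨1, fun n hn => hseq n (by omega)⟩)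
  rw [Complex.Gamma_add_one _ hν0, norm_mul] at hlim
  have := norm_pos_iff.2 hG
  have := norm_pos_iff.2 hν0
  rw [norm_div, div_pow, div_le_div_iff₀ (by positivity) (by positivity)]
  nlinarith

theorem choose_add_sub_one_eq_poch (a : ℂ) (n : ℕ) :
    Ring.choose (a + n - 1) n = poch a n / n.factorial := by
  have := Ring.factorial_nsmul_multichoose_eq_ascPochhammer a n
  rw [Ring.multichoose_eq, Polynomial.ascPochhammer_smeval_eq_eval, nsmul_eq_mul] at this
  rw [poch, ← this, mul_div_cancel_left₀]
  exact_mod_cast n.factorial_ne_zero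

theorem summable_norm_poch_div_factorial (a : ℂ) {r : ℝ} (h0 : 0 ≤ r) (hr : r < 1) :
    Summable fun n : ℕ => ‖poch a n / n.factorial‖ * r ^ n := by
  have h := Complex.one_div_one_sub_cpow_hasFPowerSeriesOnBall_zero a
  lift r to NNReal using h0
  have h1 := FormalMultilinearSeries.summable_norm_mul_pow (r := r) _
    (lt_of_lt_of_le (by exact_mod_cast hr) h.r_le)
  simpa [choose_add_sub_one_eq_poch] using h1

theorem hasSum_poch_div_factorial (a : ℂ) {z : ℂ} (hz : ‖z‖ < 1) :
    HasSum (fun n : ℕ => poch a n / n.factorial * z ^ n) ((1 - z) ^ (-a)) := by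
  have h := Complex.one_div_one_sub_cpow_hasFPowerSeriesOnBall_zero a
  have h1 := h.hasSum (y := z) (by simpa [enorm_eq_nnnorm] using! hz)
  simpa [choose_add_sub_one_eq_poch, Complex.cpow_neg, mul_comm] using h1

/-! ### The Legendre function of the second kind -/

theorem hasSum_integral_mul {α : Type*} [MeasurableSpace α] {m : Measure α} {f : α → ℂ}
    (hf : Integrable f m) {g : ℕ → α → ℂ} (hg : ∀ k, AEStronglyMeasurable (g k) m)
    {B : ℕ → ℝ} (hB : Summable B) (hgB : ∀ k, ∀ᵐ s ∂m, ‖g k s‖ ≤ B k) {G : α → ℂ}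
    (hG : ∀ᵐ s ∂m, HasSum (fun k => g k s) (G s)) :
    HasSum (fun k => ∫ s, f s * g k s ∂m) (∫ s, f s * G s ∂m) := by
  refine hasSum_integral_of_dominated_convergence (fun k s => ‖f s‖ * B k)
    (fun k => hf.aestronglyMeasurable.mul (hg k)) (fun k => ?_)
    (Filter.Eventually.of_forall fun s => hB.mul_left _) ?_ ?_
  · filter_upwards [hgB k] with s hs
    rw [norm_mul]
    gcongr
  · simp_rw [tsum_mul_left]
    exact hf.norm.mul_const _
  · filter_upwards [hG] with s hs
    exact hs.mul_left _

/-- The Legendre function of the second kind `Q_{μ-1}((a + a⁻¹) / 2)`, for `0 < a < 1` and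
`0 < Re μ`. -/
noncomputable def legendreQ (a : ℝ) (μ : ℂ) : ℂ :=
  ∫ w in Set.Ioo 0 a, (w : ℂ) ^ (μ - 1) / (√((a - w) * (a⁻¹ - w)) : ℂ)

/-- The `k`-th term of the expansion of `legendreQ a μ`. -/
noncomputable def legendreQTerm (a : ℝ) (μ : ℂ) (k : ℕ) : ℂ :=
  (a : ℂ) ^ μ * (poch (1 / 2) k / k.factorial * (a : ℂ) ^ (2 * k) *
    Complex.betaIntegral (μ + k) (1 / 2))

theorem cpow_one_half_sub_one {r : ℝ} (hr : 0 ≤ r) :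
    (r : ℂ) ^ (1 / 2 - 1 : ℂ) = (√r : ℂ)⁻¹ := by
  have e : (1 / 2 - 1 : ℂ) = ((-(1 / 2) : ℝ) : ℂ) := by push_cast; ring
  rw [e, ← Complex.ofReal_cpow hr, Real.rpow_neg hr, Real.sqrt_eq_rpow]
  push_cast
  rfl

theorem cpow_neg_one_half {r : ℝ} (hr : 0 ≤ r) :
    (r : ℂ) ^ (-(1 / 2) : ℂ) = (√r : ℂ)⁻¹ := by
  rw [← cpow_one_half_sub_one hr]
  norm_num

/-- With `w = a s`, the radicand becomes `(1 - s)(1 - a² s)`: a beta density times a factor that is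
analytic in `a²`. -/
theorem legendreQ_eq_integral {a : ℝ} (h0 : 0 < a) (h1 : a < 1) (μ : ℂ) :
    legendreQ a μ = (a : ℂ) ^ μ * ∫ s in (0 : ℝ)..1,
      ((s : ℂ) ^ (μ - 1) * (1 - (s : ℂ)) ^ (1 / 2 - 1 : ℂ)) *
        (1 - ((a ^ 2 * s : ℝ) : ℂ)) ^ (-(1 / 2) : ℂ) := by
  have ha0 : (a : ℂ) ≠ 0 := by exact_mod_cast h0.ne'
  rw [legendreQ, ← integral_Ioc_eq_integral_Ioo, ← intervalIntegral.integral_of_le h0.le]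
  have h := intervalIntegral.integral_comp_mul_left (a := 0) (b := 1)
    (fun w : ℝ => (w : ℂ) ^ (μ - 1) / (√((a - w) * (a⁻¹ - w)) : ℂ)) h0.ne'
  rw [mul_zero, mul_one, eq_inv_smul_iff₀ h0.ne'] at h
  have hpow : (a : ℂ) ^ μ = a * (a : ℂ) ^ (μ - 1) := by
    rw [Complex.cpow_sub _ _ ha0, Complex.cpow_one, mul_div_cancel₀ _ ha0]
  rw [← h, Complex.real_smul, hpow, mul_assoc]
  congr 1
  rw [← intervalIntegral.integral_const_mul]
  refine intervalIntegral.integral_congr fun s hs => ?_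
  rw [Set.uIcc_of_le zero_le_one] at hs
  have e1 : 0 ≤ 1 - s := by linarith [hs.2]
  have e2 : 0 ≤ 1 - a ^ 2 * s := by nlinarith [hs.1, hs.2]
  have e3 : (a - a * s) * (a⁻¹ - a * s) = (1 - s) * (1 - a ^ 2 * s) := by
    field_simp
  have e4 : (1 - (s : ℂ)) = ((1 - s : ℝ) : ℂ) := by push_cast; ring
  have e5 : (1 - ((a ^ 2 * s : ℝ) : ℂ)) = ((1 - a ^ 2 * s : ℝ) : ℂ) := by push_cast; ring
  rw [e3, e4, e5, cpow_one_half_sub_one e1, cpow_neg_one_half e2, Real.sqrt_mul e1,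
    Complex.ofReal_mul a s, Complex.mul_cpow_ofReal_nonneg h0.le hs.1, Complex.ofReal_mul]
  field_simp

/-- Binomial expansion of `(1 - a² s)^{-1/2}`, integrated termwise against the beta density. It
holds for all `Re μ > 0`, so this series, rather than the one in powers of `x⁻¹`, serves for bounds
and holomorphy. -/
theorem hasSum_legendreQTerm {a : ℝ} (h0 : 0 < a) (h1 : a < 1) {μ : ℂ} (hμ : 0 < μ.re) :
    HasSum (legendreQTerm a μ) (legendreQ a μ) := by
  rw [legendreQ_eq_integral h0 h1]
  rw [intervalIntegral.integral_of_le zero_le_one]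
  have hf := Complex.betaIntegral_convergent (u := μ) (v := 1 / 2) hμ (by norm_num)
  rw [intervalIntegrable_iff_integrableOn_Ioc_of_le zero_le_one] at hf
  have ha2 : a ^ 2 < 1 := by nlinarith
  have key := hasSum_integral_mul (m := volume.restrict (Set.Ioc (0 : ℝ) 1)) hf
    (g := fun k s => poch (1 / 2) k / k.factorial * ((a ^ 2 * s : ℝ) : ℂ) ^ k)
    (B := fun k => ‖poch (1 / 2) k / k.factorial‖ * (a ^ 2) ^ k)
    (G := fun s => (1 - ((a ^ 2 * s : ℝ) : ℂ)) ^ (-(1 / 2) : ℂ))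
    (fun k => Continuous.aestronglyMeasurable (by fun_prop))
    (summable_norm_poch_div_factorial _ (by positivity) ha2)
    (fun k => ?_) ?_
  · convert! key.mul_left ((a : ℂ) ^ μ) using 1
    funext k
    rw [legendreQTerm]
    congr 1
    rw [Complex.betaIntegral, intervalIntegral.integral_of_le zero_le_one, ← integral_const_mul]
    refine setIntegral_congr_fun measurableSet_Ioc fun s hs => ?_
    have hs0 : (s : ℂ) ≠ 0 := by exact_mod_cast hs.1.ne'
    have e : (μ + k - 1) = (μ - 1) + k := by ring
    simp only [e, Complex.cpow_add _ _ hs0, Complex.cpow_natCast]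
    push_cast
    ring
  · filter_upwards [ae_restrict_mem measurableSet_Ioc] with s hs
    rw [norm_mul, norm_pow, Complex.norm_real, Real.norm_of_nonneg (by have := hs.1; positivity)]
    gcongr
    · have := hs.1; positivity
    · exact mul_le_of_le_one_right (by positivity) hs.2
  · filter_upwards [ae_restrict_mem measurableSet_Ioc] with s hs
    refine hasSum_poch_div_factorial _ ?_
    rw [Complex.norm_real, Real.norm_of_nonneg (by have := hs.1; positivity)]
    nlinarith [hs.2]

theorem betaIntegral_one_half {μ : ℂ} (hμ : 0 < μ.re) :
    Complex.betaIntegral μ (1 / 2) =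
      Complex.Gamma μ / Complex.Gamma (μ + 1 / 2) * Complex.Gamma (1 / 2) := by
  have h := Complex.Gamma_mul_Gamma_eq_betaIntegral hμ (t := 1 / 2) (by norm_num)
  have hG : Complex.Gamma (μ + 1 / 2) ≠ 0 := by
    refine Complex.Gamma_ne_zero_of_re_pos ?_
    simp
    linarith
  rw [div_mul_eq_mul_div, h, mul_div_cancel_left₀ _ hG]

theorem norm_betaIntegral_one_half_le {σ : ℝ} (hσ : 0 < σ) {μ : ℂ} (hμ : σ ≤ μ.re) (k : ℕ) :
    ‖Complex.betaIntegral (μ + k) (1 / 2)‖ ≤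
      √(Real.exp (1 / (4 * σ))) * ‖Complex.Gamma (1 / 2)‖ / √‖μ‖ := by
  have hk : (0 : ℝ) ≤ k := k.cast_nonneg
  have hre : σ ≤ (μ + k).re := by simp; linarith
  have hμ0 : 0 < ‖μ‖ := (hσ.trans_le hμ).trans_le (Complex.re_le_norm μ)
  -- This makes the bound independent of `k`, so that only the binomial coefficients have to be
  -- summed.
  have hle : ‖μ‖ ≤ ‖μ + k‖ := by
    rw [← sq_le_sq₀ (norm_nonneg _) (norm_nonneg _), Complex.sq_norm, Complex.sq_norm,
      Complex.normSq_apply, Complex.normSq_apply]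
    simp
    nlinarith
  have h := norm_Gamma_div_Gamma_add_half_sq_le (hσ.trans_le hre)
  have h2 : ‖Complex.Gamma (μ + k) / Complex.Gamma (μ + k + 1 / 2)‖ ^ 2 ≤
      Real.exp (1 / (4 * σ)) / ‖μ‖ := by
    refine h.trans ?_
    gcongr
  rw [betaIntegral_one_half (hσ.trans_le hre), norm_mul, mul_div_right_comm,
    ← Real.sqrt_div (Real.exp_pos _).le]
  gcongr
  exact Real.le_sqrt_of_sq_le h2

theorem norm_legendreQTerm_le {σ : ℝ} (hσ : 0 < σ) {a : ℝ} (h0 : 0 < a)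
    {μ : ℂ} (hμ : σ ≤ μ.re) (k : ℕ) :
    ‖legendreQTerm a μ k‖ ≤ √(Real.exp (1 / (4 * σ))) * ‖Complex.Gamma (1 / 2)‖ / √‖μ‖ *
      a ^ μ.re * (‖poch (1 / 2) k / k.factorial‖ * (a ^ 2) ^ k) := by
  rw [legendreQTerm, norm_mul, norm_mul, norm_mul, Complex.norm_cpow_eq_rpow_re_of_pos h0,
    norm_pow, Complex.norm_real, Real.norm_of_nonneg h0.le, pow_mul]
  have := norm_betaIntegral_one_half_le hσ hμ k
  calc _ ≤ a ^ μ.re * (‖poch (1 / 2) k / k.factorial‖ * (a ^ 2) ^ k *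
        (√(Real.exp (1 / (4 * σ))) * ‖Complex.Gamma (1 / 2)‖ / √‖μ‖)) := by gcongr
    _ = _ := by ring

theorem exists_norm_legendreQ_le {σ : ℝ} (hσ : 0 < σ) {a₀ : ℝ} (h1 : a₀ < 1) :
    ∃ C, 0 ≤ C ∧ ∀ a, 0 < a → a ≤ a₀ → ∀ μ : ℂ, σ ≤ μ.re →
      ‖legendreQ a μ‖ ≤ C * a ^ μ.re / √‖μ‖ := by
  by_cases hpos : 0 < a₀
  swap
  · exact ⟨0, le_rfl, fun a h h' => absurd (h.trans_le h') hpos⟩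
  have hS := summable_norm_poch_div_factorial (1 / 2) (r := a₀ ^ 2) (by positivity) (by nlinarith)
  refine ⟨√(Real.exp (1 / (4 * σ))) * ‖Complex.Gamma (1 / 2)‖ *
    ∑' k : ℕ, ‖poch (1 / 2) k / k.factorial‖ * (a₀ ^ 2) ^ k, by positivity,
    fun a h0 ha μ hμ => ?_⟩
  rw [← (hasSum_legendreQTerm h0 (ha.trans_lt h1) (hσ.trans_le hμ)).tsum_eq]
  refine (tsum_of_norm_bounded (hS.hasSum.mul_left (√(Real.exp (1 / (4 * σ))) *
    ‖Complex.Gamma (1 / 2)‖ / √‖μ‖ * a ^ μ.re)) fun k => ?_).trans_eq ?_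
  · refine (norm_legendreQTerm_le hσ h0 hμ k).trans ?_
    gcongr
  · ring

theorem differentiableOn_legendreQ {a : ℝ} (h0 : 0 < a) (h1 : a < 1) {σ : ℝ} (hσ : 0 < σ) :
    DifferentiableOn ℂ (legendreQ a) {μ | σ < μ.re} := by
  have hS := summable_norm_poch_div_factorial (1 / 2) (r := a ^ 2) (by positivity) (by nlinarith)
  have hopen : IsOpen {μ : ℂ | σ < μ.re} := isOpen_lt continuous_const Complex.continuous_re
  have hd := Complex.differentiableOn_tsum_of_summable_norm (F := fun k μ => legendreQTerm a μ k)
    (hS.mul_left (√(Real.exp (1 / (4 * σ))) * ‖Complex.Gamma (1 / 2)‖ / √σ)) (fun k => ?_) hopen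
    fun k μ hμ => ?_
  · refine hd.congr fun μ hμ => ?_
    exact (hasSum_legendreQTerm h0 h1 (hσ.trans hμ)).tsum_eq.symm
  · refine DifferentiableOn.mul ?_ (DifferentiableOn.const_mul ?_ _)
    · exact fun μ _ => (DifferentiableAt.const_cpow differentiableAt_id
        (Or.inl (by exact_mod_cast h0.ne'))).differentiableWithinAt
    · have hdiff : DifferentiableOn ℂ (fun μ : ℂ => Complex.Gamma (μ + k) /
          Complex.Gamma (μ + k + 1 / 2) * Complex.Gamma (1 / 2)) {μ | σ < μ.re} := by
        intro μ hμ
        have hk : (0 : ℝ) ≤ k := k.cast_nonneg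
        have hμ' : σ < μ.re := hμ
        have hd (c : ℂ) (hc : 0 < c.re) : DifferentiableAt ℂ Complex.Gamma c := by
          refine Complex.differentiableAt_Gamma _ fun m h => ?_
          rw [h] at hc
          have hm : (0 : ℝ) ≤ m := m.cast_nonneg
          simp at hc
          linarith
        have e1 : 0 < (μ + k).re := by simp; linarith
        have e2 : 0 < (μ + k + 1 / 2).re := by simp; linarith
        have d1 : DifferentiableAt ℂ (fun μ : ℂ => Complex.Gamma (μ + k)) μ :=
          (hd _ e1).comp (f := fun μ : ℂ => μ + k) μ (by fun_prop)
        have d2 : DifferentiableAt ℂ (fun μ : ℂ => Complex.Gamma (μ + k + 1 / 2)) μ :=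
          (hd _ e2).comp (f := fun μ : ℂ => μ + k + 1 / 2) μ (by fun_prop)
        exact ((d1.div d2 (Complex.Gamma_ne_zero_of_re_pos e2)).mul_const
          _).differentiableWithinAt
      refine hdiff.congr fun μ hμ => betaIntegral_one_half ?_
      have hk : (0 : ℝ) ≤ k := k.cast_nonneg
      have hμ' : σ < μ.re := hμ
      simp
      linarith
  · have hμ' : σ < μ.re := hμ
    refine (norm_legendreQTerm_le hσ h0 hμ'.le k).trans ?_
    have e1 : a ^ μ.re ≤ 1 := Real.rpow_le_one h0.le h1.le (by linarith)
    have e2 : σ ≤ ‖μ‖ := hμ'.le.trans (Complex.re_le_norm μ)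
    have : 0 < σ := hσ
    gcongr
    refine (mul_le_of_le_one_right (by positivity) e1).trans ?_
    gcongr

/-! ### The quadratic transformation -/

/-- The point `(a + a⁻¹) / 2`. -/
noncomputable def joukowski (a : ℝ) : ℝ := (a + a⁻¹) / 2

theorem one_lt_joukowski {a : ℝ} (h0 : 0 < a) (h1 : a < 1) : 1 < joukowski a := by
  rw [joukowski, lt_div_iff₀ two_pos]
  have : a * a⁻¹ = 1 := mul_inv_cancel₀ h0.ne'
  have h2 : 1 < a⁻¹ := (one_lt_inv₀ h0).2 h1
  nlinarith

/-- The two-to-one substitution `t ↦ (1 - t²) / (2 (x - t))`, for `x = (a + a⁻¹) / 2`. -/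
noncomputable def quadSubst (a t : ℝ) : ℝ := (1 - t ^ 2) / (2 * (joukowski a - t))

section quadSubst

variable {a t : ℝ}

/-- The points `a` and `a⁻¹` are both fixed points and critical points of the substitution, hence
the perfect squares here and in `inv_sub_quadSubst`. -/
theorem sub_quadSubst (h0 : 0 < a) (hx : t < joukowski a) :
    a - quadSubst a t = (t - a) ^ 2 / (2 * (joukowski a - t)) := by
  have : joukowski a - t ≠ 0 := by linarith
  rw [quadSubst, eq_div_iff (by positivity), sub_mul, div_mul_cancel₀ _ (by positivity), joukowski]
  field_simp
  ring

theorem inv_sub_quadSubst (h0 : 0 < a) (hx : t < joukowski a) :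
    a⁻¹ - quadSubst a t = (t - a⁻¹) ^ 2 / (2 * (joukowski a - t)) := by
  have : joukowski a - t ≠ 0 := by linarith
  rw [quadSubst, eq_div_iff (by positivity), sub_mul, div_mul_cancel₀ _ (by positivity), joukowski]
  field_simp
  ring

theorem sqrt_quadSubst (h0 : 0 < a) (hx : t < joukowski a) :
    √((a - quadSubst a t) * (a⁻¹ - quadSubst a t)) =
      |(t - a) * (t - a⁻¹)| / (2 * (joukowski a - t)) := by
  have : 0 < joukowski a - t := by linarith
  rw [sub_quadSubst h0 hx, inv_sub_quadSubst h0 hx, div_mul_div_comm, ← mul_pow, ← sq,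
    Real.sqrt_div (sq_nonneg _), Real.sqrt_sq_eq_abs, Real.sqrt_sq (by positivity)]

theorem quadSubst_sub_self (h0 : 0 < a) (hx : t < joukowski a) :
    quadSubst a t - t = (t - a) * (t - a⁻¹) / (2 * (joukowski a - t)) := by
  have : joukowski a - t ≠ 0 := by linarith
  rw [quadSubst, eq_div_iff (by positivity), sub_mul, div_mul_cancel₀ _ (by positivity), joukowski]
  field_simp
  ring

theorem hasDerivAt_quadSubst (h0 : 0 < a) (hx : t < joukowski a) :
    HasDerivAt (quadSubst a) ((t - a) * (t - a⁻¹) / (2 * (joukowski a - t) ^ 2)) t := by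
  have : joukowski a - t ≠ 0 := by linarith
  have h1 : HasDerivAt (fun t : ℝ => 1 - t ^ 2) (-(2 * t)) t := by
    simpa using (hasDerivAt_pow 2 t).const_sub 1
  have h2 : HasDerivAt (fun t : ℝ => 2 * (joukowski a - t)) (2 * -1) t :=
    ((hasDerivAt_id t).const_sub _).const_mul 2
  refine (h1.div h2 (by positivity)).congr_deriv ?_
  have e : joukowski a = (a + a⁻¹) / 2 := rfl
  rw [div_eq_div_iff (by positivity) (by positivity)]
  have e2 : a⁻¹ = 2 * joukowski a - a := by rw [e]; ring
  have e3 : a * (2 * joukowski a - a) = 1 := by rw [← e2]; exact mul_inv_cancel₀ h0.ne'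
  rw [e2]
  linear_combination (-4 * (joukowski a - t) ^ 2) * e3

/-- The Jacobian and the square root both carry the factor `|(t - a)(t - a⁻¹)|`; it cancels, and the
singularity at `t = a` disappears. -/
theorem abs_deriv_mul_quadSubst (h0 : 0 < a) (hx : t < joukowski a) (hta : (t - a) * (t - a⁻¹) ≠ 0)
    (μ : ℂ) :
    |(t - a) * (t - a⁻¹) / (2 * (joukowski a - t) ^ 2)| • ((quadSubst a t : ℂ) ^ (μ - 1) /
      (√((a - quadSubst a t) * (a⁻¹ - quadSubst a t)) : ℂ)) =
      (quadSubst a t : ℂ) ^ (μ - 1) / ((joukowski a - t : ℝ) : ℂ) := by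
  have hpos : 0 < joukowski a - t := by linarith
  rw [sqrt_quadSubst h0 hx, abs_div, abs_of_pos (a := 2 * (joukowski a - t) ^ 2) (by positivity)]
  have h3 := abs_pos.2 hta
  set A := |(t - a) * (t - a⁻¹)|
  have hA : (A : ℂ) ≠ 0 := by exact_mod_cast h3.ne'
  have hJ : ((joukowski a - t : ℝ) : ℂ) ≠ 0 := by exact_mod_cast hpos.ne'
  generalize joukowski a - t = J at *
  rw [Complex.real_smul]
  push_cast
  field_simp

theorem sqrt_sub_mul_inv_sub_sq (h1 : a < 1) (h0 : 0 < a) {w : ℝ} (hw : w < a) :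
    √((a - w) * (a⁻¹ - w)) ^ 2 = w ^ 2 - 2 * w * joukowski a + 1 := by
  have h2 : 1 < a⁻¹ := (one_lt_inv₀ h0).2 h1
  rw [Real.sq_sqrt (mul_nonneg (by linarith) (by linarith)), joukowski]
  field_simp
  ring

theorem quadSubst_eq_of_sq {w : ℝ} (hx : t < joukowski a)
    (h : (t - w) ^ 2 = w ^ 2 - 2 * w * joukowski a + 1) : quadSubst a t = w := by
  have : joukowski a - t ≠ 0 := by linarith
  rw [quadSubst, div_eq_iff (by positivity)]
  linarith

theorem quadSubst_mem (h0 : 0 < a) (h1 : a < 1) (ht : t ∈ Set.Ioo (-1) 1) (hta : t ≠ a) :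
    quadSubst a t ∈ Set.Ioo 0 a := by
  have hx : t < joukowski a := ht.2.trans (one_lt_joukowski h0 h1)
  have hpos : 0 < joukowski a - t := by linarith
  constructor
  · exact div_pos (by nlinarith [ht.1, ht.2]) (by positivity)
  · have := sub_quadSubst h0 hx
    have h2 : 0 < (t - a) ^ 2 / (2 * (joukowski a - t)) :=
      div_pos (by positivity [sub_ne_zero.2 hta]) (by positivity)
    linarith

/-- The equation `quadSubst a t = w` is quadratic in `t`, with roots `w ± √((a - w)(a⁻¹ - w))`. The
minus root lies in `(-1, a)`, the plus root in `(a, 1)`. -/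
theorem image_quadSubst_left (h0 : 0 < a) (h1 : a < 1) :
    quadSubst a '' Set.Ioo (-1) a = Set.Ioo 0 a := by
  have hJ := one_lt_joukowski h0 h1
  refine Set.Subset.antisymm ?_ fun w hw => ?_
  · rintro _ ⟨t, ht, rfl⟩
    exact quadSubst_mem h0 h1 ⟨ht.1, ht.2.trans h1⟩ ht.2.ne
  · have hR := sqrt_sub_mul_inv_sub_sq h1 h0 hw.2
    set R := √((a - w) * (a⁻¹ - w))
    have hR0 : 0 ≤ R := Real.sqrt_nonneg _
    have h3 : R < 1 + w := by
      refine lt_of_pow_lt_pow_left₀ 2 (by linarith [hw.1]) ?_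
      nlinarith [hw.1]
    refine ⟨w - R, ⟨by linarith, by linarith [hw.2]⟩, quadSubst_eq_of_sq (by linarith [hw.2]) ?_⟩
    rw [← hR]
    ring

theorem image_quadSubst_right (h0 : 0 < a) (h1 : a < 1) :
    quadSubst a '' Set.Ioo a 1 = Set.Ioo 0 a := by
  have hJ := one_lt_joukowski h0 h1
  refine Set.Subset.antisymm ?_ fun w hw => ?_
  · rintro _ ⟨t, ht, rfl⟩
    exact quadSubst_mem h0 h1 ⟨by linarith [ht.1], ht.2⟩ ht.1.ne'
  · have hR := sqrt_sub_mul_inv_sub_sq h1 h0 hw.2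
    have h2 : 1 < a⁻¹ := (one_lt_inv₀ h0).2 h1
    have h4 : a - w < √((a - w) * (a⁻¹ - w)) := by
      refine Real.lt_sqrt_of_sq_lt ?_
      nlinarith [hw.2]
    set R := √((a - w) * (a⁻¹ - w))
    have hR0 : 0 ≤ R := Real.sqrt_nonneg _
    have h3 : R < 1 - w := by
      refine lt_of_pow_lt_pow_left₀ 2 (by linarith [hw.2]) ?_
      nlinarith [hw.1]
    refine ⟨w + R, ⟨by linarith, by linarith⟩, quadSubst_eq_of_sq (by linarith [hw.2]) ?_⟩
    rw [← hR]
    ring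

/-- The minus root is an explicit left inverse, since on this branch `(t - a)(t - a⁻¹) ≥ 0` fixes
the sign of the square root. -/
theorem injOn_quadSubst_left (h0 : 0 < a) (h1 : a < 1) :
    Set.InjOn (quadSubst a) (Set.Ioo (-1) a) := by
  have h2 : 1 < a⁻¹ := (one_lt_inv₀ h0).2 h1
  refine Set.LeftInvOn.injOn (f₁' := fun w => w - √((a - w) * (a⁻¹ - w))) fun t ht => ?_
  have hx : t < joukowski a := (ht.2.trans h1).trans (one_lt_joukowski h0 h1)
  have hsgn : 0 ≤ (t - a) * (t - a⁻¹) := by nlinarith [ht.2]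
  beta_reduce
  rw [sqrt_quadSubst h0 hx, abs_of_nonneg hsgn, ← quadSubst_sub_self h0 hx]
  ring

theorem injOn_quadSubst_right (h0 : 0 < a) (h1 : a < 1) :
    Set.InjOn (quadSubst a) (Set.Ioo a 1) := by
  have h2 : 1 < a⁻¹ := (one_lt_inv₀ h0).2 h1
  refine Set.LeftInvOn.injOn (f₁' := fun w => w + √((a - w) * (a⁻¹ - w))) fun t ht => ?_
  have hx : t < joukowski a := ht.2.trans (one_lt_joukowski h0 h1)
  have hsgn : (t - a) * (t - a⁻¹) ≤ 0 := by nlinarith [ht.1, ht.2]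
  beta_reduce
  rw [sqrt_quadSubst h0 hx, abs_of_nonpos hsgn, neg_div, ← quadSubst_sub_self h0 hx]
  ring

theorem legendreQ_eq_integral_left (h0 : 0 < a) (h1 : a < 1) (μ : ℂ) :
    legendreQ a μ = ∫ t in Set.Ioo (-1) a,
      (quadSubst a t : ℂ) ^ (μ - 1) / ((joukowski a - t : ℝ) : ℂ) := by
  have h2 : 1 < a⁻¹ := (one_lt_inv₀ h0).2 h1
  have hx (t : ℝ) (ht : t ∈ Set.Ioo (-1) a) : t < joukowski a :=
    (ht.2.trans h1).trans (one_lt_joukowski h0 h1)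
  rw [legendreQ, ← image_quadSubst_left h0 h1, integral_image_eq_integral_abs_deriv_smul
    measurableSet_Ioo (fun t ht => (hasDerivAt_quadSubst h0 (hx t ht)).hasDerivWithinAt)
    (injOn_quadSubst_left h0 h1)]
  refine setIntegral_congr_fun measurableSet_Ioo fun t ht => ?_
  refine abs_deriv_mul_quadSubst h0 (hx t ht) (mul_ne_zero ?_ ?_) μ
  · linarith [ht.2]
  · linarith [ht.2]

theorem legendreQ_eq_integral_right (h0 : 0 < a) (h1 : a < 1) (μ : ℂ) :
    legendreQ a μ = ∫ t in Set.Ioo a 1,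
      (quadSubst a t : ℂ) ^ (μ - 1) / ((joukowski a - t : ℝ) : ℂ) := by
  have h2 : 1 < a⁻¹ := (one_lt_inv₀ h0).2 h1
  have hx (t : ℝ) (ht : t ∈ Set.Ioo a 1) : t < joukowski a :=
    ht.2.trans (one_lt_joukowski h0 h1)
  rw [legendreQ, ← image_quadSubst_right h0 h1, integral_image_eq_integral_abs_deriv_smul
    measurableSet_Ioo (fun t ht => (hasDerivAt_quadSubst h0 (hx t ht)).hasDerivWithinAt)
    (injOn_quadSubst_right h0 h1)]
  refine setIntegral_congr_fun measurableSet_Ioo fun t ht => ?_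
  refine abs_deriv_mul_quadSubst h0 (hx t ht) (mul_ne_zero ?_ ?_) μ
  · linarith [ht.1]
  · linarith [ht.2]

end quadSubst

/-! ### The hypergeometric expansion -/

theorem poch_zero (a : ℂ) : poch a 0 = 1 := by simp [poch]

theorem poch_succ (a : ℂ) (k : ℕ) : poch a (k + 1) = poch a k * (a + k) := by
  simp [poch, ascPochhammer_succ_eval]

theorem poch_ne_zero {a : ℂ} (ha : 0 < a.re) (k : ℕ) : poch a k ≠ 0 := by
  induction k with
  | zero => simp [poch_zero]
  | succ k ih =>
    rw [poch_succ]
    refine mul_ne_zero ih fun h => ?_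
    have := congrArg Complex.re h
    have hk : (0 : ℝ) ≤ k := k.cast_nonneg
    simp at this
    linarith

theorem Gamma_add_natCast {a : ℂ} (ha : 0 < a.re) (k : ℕ) :
    Complex.Gamma (a + k) = poch a k * Complex.Gamma a := by
  induction k with
  | zero => simp [poch_zero]
  | succ k ih =>
    have : a + k ≠ 0 := by
      intro h
      have := congrArg Complex.re h
      have hk : (0 : ℝ) ≤ k := k.cast_nonneg
      simp at this
      linarith
    rw [Nat.cast_succ, ← add_assoc, Complex.Gamma_add_one _ this, ih, poch_succ]
    ring

theorem poch_two_mul (a : ℂ) (k : ℕ) :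
    poch a (2 * k) = 4 ^ k * poch (a / 2) k * poch ((a + 1) / 2) k := by
  induction k with
  | zero => simp [poch_zero]
  | succ k ih =>
    rw [show 2 * (k + 1) = 2 * k + 1 + 1 by ring, poch_succ, poch_succ, poch_succ, poch_succ, ih]
    push_cast
    ring

theorem factorial_two_mul_eq_poch (k : ℕ) :
    ((2 * k).factorial : ℂ) = 4 ^ k * k.factorial * poch (1 / 2) k := by
  induction k with
  | zero => simp [poch_zero]
  | succ k ih =>
    rw [show 2 * (k + 1) = 2 * k + 1 + 1 by ring, Nat.factorial_succ, Nat.factorial_succ,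
      Nat.factorial_succ k, poch_succ]
    push_cast
    rw [ih]
    ring

theorem norm_one_sub_sq_cpow_le {μ : ℂ} (hμ : 1 ≤ μ.re) {t : ℝ} (ht : t ∈ Set.Ioc (-1) 1) :
    ‖((1 - t ^ 2 : ℝ) : ℂ) ^ (μ - 1)‖ ≤ 1 := by
  have h0 : 0 ≤ 1 - t ^ 2 := by nlinarith [ht.1, ht.2]
  -- At `t = 1` the base vanishes; by convention `0 ^ (μ - 1)` is `1` if `μ = 1` and `0` otherwise.
  rcases h0.eq_or_lt with h | h
  · rw [← h, Complex.ofReal_zero]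
    by_cases h' : μ - 1 = 0
    · simp [h']
    · simp [Complex.zero_cpow h']
  · rw [Complex.norm_cpow_eq_rpow_re_of_pos h]
    refine Real.rpow_le_one h0 (by nlinarith [sq_nonneg t]) ?_
    simp
    linarith

theorem integrableOn_one_sub_sq_cpow {μ : ℂ} (hμ : 1 ≤ μ.re) :
    IntegrableOn (fun t : ℝ => ((1 - t ^ 2 : ℝ) : ℂ) ^ (μ - 1)) (Set.Ioc (-1) 1) := by
  refine Measure.integrableOn_of_bounded (M := 1) (by simp) ?_ ?_
  · exact (Measurable.pow_const (by fun_prop) _).aestronglyMeasurable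
  · filter_upwards [ae_restrict_mem measurableSet_Ioc] with t ht
    exact norm_one_sub_sq_cpow_le hμ ht

/-- The moments of `(1 - t²)^{μ-1}`. -/
noncomputable def gegenbauerMoment (μ : ℂ) (n : ℕ) : ℂ :=
  ∫ t in (-1 : ℝ)..1, ((1 - t ^ 2 : ℝ) : ℂ) ^ (μ - 1) * (t : ℂ) ^ n

theorem gegenbauerMoment_odd (μ : ℂ) (k : ℕ) : gegenbauerMoment μ (2 * k + 1) = 0 := by
  have h := intervalIntegral.integral_comp_neg (a := -1) (b := 1)
    (fun t : ℝ => ((1 - t ^ 2 : ℝ) : ℂ) ^ (μ - 1) * (t : ℂ) ^ (2 * k + 1))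
  have h2 : gegenbauerMoment μ (2 * k + 1) = - gegenbauerMoment μ (2 * k + 1) := by
    rw [neg_neg] at h
    conv_lhs => rw [gegenbauerMoment, ← h]
    rw [gegenbauerMoment, ← intervalIntegral.integral_neg]
    refine intervalIntegral.integral_congr fun t _ => ?_
    have : (-(t : ℂ)) ^ (2 * k + 1) = - (t : ℂ) ^ (2 * k + 1) := Odd.neg_pow ⟨k, rfl⟩ _
    simp [this]
  exact self_eq_neg.1 h2

theorem two_mul_integral_eq_betaIntegral (μ : ℂ) (k : ℕ) :
    2 * ∫ t in (0 : ℝ)..1, ((1 - t ^ 2 : ℝ) : ℂ) ^ (μ - 1) * (t : ℂ) ^ (2 * k) =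
      Complex.betaIntegral (1 / 2 + k) μ := by
  have himg : (fun t : ℝ => t ^ 2) '' Set.Ioo 0 1 = Set.Ioo 0 1 := by
    ext s
    constructor
    · rintro ⟨t, ht, rfl⟩
      exact ⟨pow_pos ht.1 2, pow_lt_one₀ ht.1.le ht.2 two_ne_zero⟩
    · intro hs
      exact ⟨√s, ⟨Real.sqrt_pos.2 hs.1, (Real.sqrt_lt' one_pos).2 (by simpa using hs.2)⟩,
        Real.sq_sqrt hs.1.le⟩
  have hinj : Set.InjOn (fun t : ℝ => t ^ 2) (Set.Ioo 0 1) := fun s hs t ht h =>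
    (sq_eq_sq₀ hs.1.le ht.1.le).1 h
  rw [Complex.betaIntegral, intervalIntegral.integral_of_le zero_le_one,
    intervalIntegral.integral_of_le zero_le_one, integral_Ioc_eq_integral_Ioo,
    integral_Ioc_eq_integral_Ioo, ← integral_const_mul]
  conv_rhs => rw [← himg]
  rw [integral_image_eq_integral_abs_deriv_smul measurableSet_Ioo
    (fun t _ => (hasDerivAt_pow 2 t).hasDerivWithinAt) hinj]
  refine setIntegral_congr_fun measurableSet_Ioo fun t ht => ?_
  have ht0 : (t : ℂ) ≠ 0 := by exact_mod_cast ht.1.ne'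
  have e : ((t ^ 2 : ℝ) : ℂ) ^ (1 / 2 + (k : ℂ) - 1) * t = (t : ℂ) ^ (2 * k) := by
    rw [sq, Complex.ofReal_mul, Complex.mul_cpow_ofReal_nonneg ht.1.le ht.1.le,
      ← Complex.cpow_add _ _ ht0]
    nth_rewrite 2 [← Complex.cpow_one (t : ℂ)]
    rw [← Complex.cpow_add _ _ ht0, ← Complex.cpow_natCast]
    congr 1
    push_cast
    ring
  rw [← e, Complex.real_smul, abs_of_pos (by simpa using ht.1)]
  push_cast
  ring

theorem gegenbauerMoment_even {μ : ℂ} (hμ : 1 ≤ μ.re) (k : ℕ) :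
    gegenbauerMoment μ (2 * k) = Complex.betaIntegral (1 / 2 + k) μ := by
  have h_int : IntervalIntegrable
      (fun t : ℝ => ((1 - t ^ 2 : ℝ) : ℂ) ^ (μ - 1) * (t : ℂ) ^ (2 * k)) volume (-1) 1 := by
    refine IntervalIntegrable.mul_continuousOn ?_ (by fun_prop)
    rw [intervalIntegrable_iff_integrableOn_Ioc_of_le (by norm_num)]
    exact integrableOn_one_sub_sq_cpow hμ
  have h := intervalIntegral.integral_comp_neg (a := 0) (b := 1)
    (fun t : ℝ => ((1 - t ^ 2 : ℝ) : ℂ) ^ (μ - 1) * (t : ℂ) ^ (2 * k))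
  rw [neg_zero] at h
  have hl : Set.uIcc (-1 : ℝ) 0 ⊆ Set.uIcc (-1) 1 :=
    Set.uIcc_subset_uIcc_left (by rw [Set.uIcc_of_le] <;> norm_num)
  have hr : Set.uIcc (0 : ℝ) 1 ⊆ Set.uIcc (-1) 1 :=
    Set.uIcc_subset_uIcc_right (by rw [Set.uIcc_of_le] <;> norm_num)
  rw [← two_mul_integral_eq_betaIntegral, gegenbauerMoment,
    ← intervalIntegral.integral_add_adjacent_intervals (h_int.mono_set hl) (h_int.mono_set hr), ← h]
  refine Eq.trans ?_ (two_mul _).symm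
  congr 1
  refine intervalIntegral.integral_congr fun t _ => ?_
  simp [pow_mul]

theorem quadSubst_cpow_div {a : ℝ} (h0 : 0 < a) (h1 : a < 1) (μ : ℂ) {t : ℝ}
    (ht : t ∈ Set.Ioc (-1) 1) :
    (quadSubst a t : ℂ) ^ (μ - 1) / ((joukowski a - t : ℝ) : ℂ) =
      ((1 - t ^ 2 : ℝ) : ℂ) ^ (μ - 1) * (2 * (2 : ℂ) ^ (-μ) * (joukowski a : ℂ) ^ (-μ) *
        (1 - ((t / joukowski a : ℝ) : ℂ)) ^ (-μ)) := by
  have hJ := one_lt_joukowski h0 h1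
  have hJ0 : 0 < joukowski a := by linarith
  have hy : 0 < joukowski a - t := by linarith [ht.2]
  have e0 : 0 ≤ 1 - t ^ 2 := by nlinarith [ht.1, ht.2]
  have e1 : (0 : ℝ) < 2 * (joukowski a - t) := by positivity
  have e1' : ((2 * (joukowski a - t) : ℝ) : ℂ) ≠ 0 := by exact_mod_cast e1.ne'
  have e2 : 0 < 1 - t / joukowski a := by
    rw [sub_pos, div_lt_one hJ0]
    linarith [ht.2]
  have e3 : 2 * (joukowski a - t) = 2 * (joukowski a * (1 - t / joukowski a)) := by
    field_simp
  have e4 : (1 - ((t / joukowski a : ℝ) : ℂ)) = ((1 - t / joukowski a : ℝ) : ℂ) := by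
    push_cast; ring
  have e5 : (((2 * (joukowski a - t))⁻¹ : ℝ) : ℂ) ^ (μ - 1) / ((joukowski a - t : ℝ) : ℂ) =
      2 * ((2 * (joukowski a - t) : ℝ) : ℂ) ^ (-μ) := by
    rw [Complex.ofReal_inv, Complex.inv_cpow _ _ (by
      rw [Complex.arg_ofReal_of_nonneg e1.le]; exact Real.pi_pos.ne), Complex.cpow_sub _ _ e1',
      Complex.cpow_one, Complex.cpow_neg]
    push_cast
    have : ((joukowski a : ℂ) - t) ≠ 0 := by exact_mod_cast hy.ne'
    field_simp
  rw [quadSubst, div_eq_mul_inv (1 - t ^ 2), Complex.ofReal_mul,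
    Complex.mul_cpow_ofReal_nonneg e0 (by positivity), mul_div_assoc, e5, e3, e4,
    Complex.ofReal_mul 2, Complex.mul_cpow_ofReal_nonneg zero_le_two (by positivity),
    Complex.ofReal_mul, Complex.mul_cpow_ofReal_nonneg hJ0.le e2.le]
  push_cast
  ring

/-- The intervals `(-1, a)` and `(a, 1)` each contribute one copy of `legendreQ a μ`, so the full
integral over `(-1, 1)` is twice it; this cancels the `2` left over from `(2 (x - t))^{-μ}`. -/
theorem legendreQ_eq_integral_Ioc {a : ℝ} (h0 : 0 < a) (h1 : a < 1) {μ : ℂ} (hμ : 1 ≤ μ.re) :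
    legendreQ a μ = (2 : ℂ) ^ (-μ) * (joukowski a : ℂ) ^ (-μ) * ∫ t in Set.Ioc (-1 : ℝ) 1,
      ((1 - t ^ 2 : ℝ) : ℂ) ^ (μ - 1) * (1 - ((t / joukowski a : ℝ) : ℂ)) ^ (-μ) := by
  have hJ := one_lt_joukowski h0 h1
  have hJ0 : 0 < joukowski a := by linarith
  have h_int : IntegrableOn (fun t : ℝ =>
      (quadSubst a t : ℂ) ^ (μ - 1) / ((joukowski a - t : ℝ) : ℂ)) (Set.Ioc (-1) 1) := by
    have : IntervalIntegrable (fun t : ℝ => ((1 - t ^ 2 : ℝ) : ℂ) ^ (μ - 1) * (2 * (2 : ℂ) ^ (-μ) *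
        (joukowski a : ℂ) ^ (-μ) * (1 - ((t / joukowski a : ℝ) : ℂ)) ^ (-μ))) volume (-1) 1 := by
      refine IntervalIntegrable.mul_continuousOn ?_ ?_
      · rw [intervalIntegrable_iff_integrableOn_Ioc_of_le (by norm_num)]
        exact integrableOn_one_sub_sq_cpow hμ
      · refine continuousOn_const.mul (ContinuousOn.cpow (by fun_prop) continuousOn_const ?_)
        intro t ht
        rw [Set.uIcc_of_le (by norm_num)] at ht
        have e4 : (1 - ((t / joukowski a : ℝ) : ℂ)) = ((1 - t / joukowski a : ℝ) : ℂ) := by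
          push_cast; ring
        rw [e4, Complex.ofReal_mem_slitPlane, sub_pos, div_lt_one hJ0]
        linarith [ht.2]
    rw [intervalIntegrable_iff_integrableOn_Ioc_of_le (by norm_num)] at this
    exact this.congr_fun (fun t ht => (quadSubst_cpow_div h0 h1 μ ht).symm) measurableSet_Ioc
  have h2 : 2 * legendreQ a μ = ∫ t in Set.Ioc (-1 : ℝ) 1,
      (quadSubst a t : ℂ) ^ (μ - 1) / ((joukowski a - t : ℝ) : ℂ) := by
    have hm : -1 ≤ a := by linarith
    rw [two_mul]
    nth_rewrite 1 [legendreQ_eq_integral_left h0 h1]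
    rw [legendreQ_eq_integral_right h0 h1, ← integral_Ioc_eq_integral_Ioo,
      ← integral_Ioc_eq_integral_Ioo, ← Set.Ioc_union_Ioc_eq_Ioc hm h1.le,
      setIntegral_union (Set.Ioc_disjoint_Ioc_of_le le_rfl) measurableSet_Ioc
        (h_int.mono_set (Set.Ioc_subset_Ioc_right h1.le))
        (h_int.mono_set (Set.Ioc_subset_Ioc_left hm))]
  refine mul_left_cancel₀ two_ne_zero (h2.trans ?_)
  rw [setIntegral_congr_fun measurableSet_Ioc fun t ht => quadSubst_cpow_div h0 h1 μ ht,
    ← integral_const_mul, ← integral_const_mul]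
  refine setIntegral_congr_fun measurableSet_Ioc fun t _ => ?_
  ring

/-- The normalising factor in the expansion of `legendreQ` at infinity. -/
noncomputable def legendreQNorm (μ : ℂ) : ℂ :=
  (2 : ℂ) ^ (-μ) * (Complex.Gamma μ / Complex.Gamma (μ + 1 / 2) * Complex.Gamma (1 / 2))

/-- The duplication identities `(μ)_{2k} = 4^k (μ/2)_k ((μ+1)/2)_k` and `(2k)! = 4^k k! (1/2)_k`
meet the beta value `B(1/2 + k, μ)`, whose `(1/2)_k` cancels and whose `(μ + 1/2)_k` is the
denominator of `b_k`. -/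
theorem poch_mul_gegenbauerMoment {μ : ℂ} (hμ : 1 ≤ μ.re) (k : ℕ) :
    poch μ (2 * k) / (2 * k).factorial * gegenbauerMoment μ (2 * k) =
      Complex.Gamma μ / Complex.Gamma (μ + 1 / 2) * Complex.Gamma (1 / 2) *
        (b k μ / k.factorial) := by
  have hμ2 : 0 < (μ + 1 / 2).re := by simp; linarith
  have hk : (0 : ℝ) ≤ k := k.cast_nonneg
  have hG : Complex.Gamma (μ + 1 / 2 + k) ≠ 0 := by
    refine Complex.Gamma_ne_zero_of_re_pos ?_
    rw [Complex.add_re, Complex.natCast_re]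
    linarith
  have hB := Complex.Gamma_mul_Gamma_eq_betaIntegral (s := 1 / 2 + k) (t := μ)
    (by simp; linarith) (by linarith)
  rw [show (1 / 2 + (k : ℂ) + μ) = μ + 1 / 2 + k by ring] at hB
  have hp : poch (μ + 1 / 2) k ≠ 0 := poch_ne_zero hμ2 k
  have hp2 : poch (1 / 2) k ≠ 0 := poch_ne_zero (by norm_num) k
  have hf : (k.factorial : ℂ) ≠ 0 := by exact_mod_cast k.factorial_ne_zero
  rw [gegenbauerMoment_even hμ, poch_two_mul, factorial_two_mul_eq_poch, b,
    ← mul_div_cancel_left₀ (Complex.betaIntegral (1 / 2 + k) μ) hG, ← hB,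
    Gamma_add_natCast (by norm_num), Gamma_add_natCast hμ2]
  have hG2 := Complex.Gamma_ne_zero_of_re_pos hμ2
  generalize Complex.Gamma (μ + 1 / 2) = G at *
  field_simp

/-- Binomial expansion of `(1 - t/x)^{-μ}`, legitimate since `|t/x| ≤ x⁻¹ < 1`, integrated against
`(1 - t²)^{μ-1}`. -/
theorem hasSum_legendreQ {a : ℝ} (h0 : 0 < a) (h1 : a < 1) {μ : ℂ} (hμ : 1 ≤ μ.re) :
    HasSum (fun k : ℕ => legendreQNorm μ *
      (b k μ / k.factorial * (joukowski a : ℂ) ^ (-(μ + 2 * k)))) (legendreQ a μ) := by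
  have hJ := one_lt_joukowski h0 h1
  have hJ0 : 0 < joukowski a := by linarith
  have hJc : (joukowski a : ℂ) ≠ 0 := by exact_mod_cast hJ0.ne'
  have hbd (t : ℝ) (ht : t ∈ Set.Ioc (-1) 1) : |t / joukowski a| ≤ (joukowski a)⁻¹ := by
    rw [abs_div, abs_of_pos hJ0, div_eq_mul_inv]
    exact mul_le_of_le_one_left (by positivity) (abs_le.2 ⟨ht.1.le, ht.2⟩)
  have key := hasSum_integral_mul (m := volume.restrict (Set.Ioc (-1 : ℝ) 1))
    (integrableOn_one_sub_sq_cpow hμ)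
    (g := fun n t => poch μ n / n.factorial * ((t / joukowski a : ℝ) : ℂ) ^ n)
    (B := fun n => ‖poch μ n / n.factorial‖ * (joukowski a)⁻¹ ^ n)
    (G := fun t => (1 - ((t / joukowski a : ℝ) : ℂ)) ^ (-μ))
    (fun k => Continuous.aestronglyMeasurable (by fun_prop))
    (summable_norm_poch_div_factorial _ (by positivity) (inv_lt_one_of_one_lt₀ hJ))
    (fun k => ?_) ?_
  rotate_left
  · filter_upwards [ae_restrict_mem measurableSet_Ioc] with t ht
    rw [norm_mul, norm_pow, Complex.norm_real, Real.norm_eq_abs]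
    gcongr
    exact hbd t ht
  · filter_upwards [ae_restrict_mem measurableSet_Ioc] with t ht
    refine hasSum_poch_div_factorial _ ?_
    rw [Complex.norm_real, Real.norm_eq_abs]
    exact (hbd t ht).trans_lt (inv_lt_one_of_one_lt₀ hJ)
  have hterm (n : ℕ) : ∫ t in Set.Ioc (-1 : ℝ) 1, ((1 - t ^ 2 : ℝ) : ℂ) ^ (μ - 1) *
      (poch μ n / n.factorial * ((t / joukowski a : ℝ) : ℂ) ^ n) =
      poch μ n / n.factorial * gegenbauerMoment μ n * ((joukowski a : ℂ) ^ n)⁻¹ := by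
    rw [gegenbauerMoment, intervalIntegral.integral_of_le (by norm_num), ← integral_const_mul,
      ← integral_mul_const]
    refine setIntegral_congr_fun measurableSet_Ioc fun t _ => ?_
    push_cast
    rw [div_pow]
    ring
  simp_rw [hterm] at key
  -- The odd moments vanish by symmetry, so the sum is reindexed along `n = 2k`.
  rw [← (mul_right_injective₀ (two_ne_zero : (2 : ℕ) ≠ 0)).hasSum_iff] at key
  · rw [legendreQ_eq_integral_Ioc h0 h1 hμ]
    convert! key.mul_left ((2 : ℂ) ^ (-μ) * (joukowski a : ℂ) ^ (-μ)) using 1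
    funext k
    rw [Function.comp_apply, poch_mul_gegenbauerMoment hμ, neg_add, Complex.cpow_add _ _ hJc,
      Complex.cpow_neg _ (2 * (k : ℂ)), legendreQNorm]
    rw [show (2 * (k : ℂ)) = ((2 * k : ℕ) : ℂ) by push_cast; ring, Complex.cpow_natCast]
    ring
  · intro n hn
    obtain ⟨k, rfl | rfl⟩ := n.even_or_odd'
    · exact absurd ⟨k, rfl⟩ hn
    · simp [gegenbauerMoment_odd]

/-! ### Shifting horizontal contours -/

open Filter Topology in
-- Cauchy's theorem on rectangles `[-T, T] × [c, d]`: the vertical sides are at most `g T · |d - c|`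
-- and vanish as `T → ∞`. Holomorphy is needed only inside, so the lines may lie on the boundary of
-- the domain.
theorem integral_horizontal_eq {f : ℂ → ℂ} {c d : ℝ} (hcd : c ≤ d)
    (hc : ContinuousOn f {z | z.im ∈ Set.Icc c d})
    (hd : DifferentiableOn ℂ f {z | z.im ∈ Set.Ioo c d})
    {g : ℝ → ℝ} (hg : Tendsto g atTop (𝓝 0)) {R : ℝ}
    (hfg : ∀ z : ℂ, z.im ∈ Set.Icc c d → R ≤ |z.re| → ‖f z‖ ≤ g |z.re|)
    (hic : Integrable fun x : ℝ => f (x + c * Complex.I))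
    (hid : Integrable fun x : ℝ => f (x + d * Complex.I)) :
    ∫ x : ℝ, f (x + c * Complex.I) = ∫ x : ℝ, f (x + d * Complex.I) := by
  have hside (s : ℝ) (hs : |s| = 1) :
      Tendsto (fun T : ℝ => ∫ y : ℝ in c..d, f ((s * T : ℝ) + y * Complex.I)) atTop (𝓝 0) := by
    rw [tendsto_zero_iff_norm_tendsto_zero]
    have hlim : Tendsto (fun T => g T * |d - c|) atTop (𝓝 0) := by
      simpa using hg.mul_const |d - c|
    refine tendsto_of_tendsto_of_tendsto_of_le_of_le' tendsto_const_nhds hlim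
      (Eventually.of_forall fun _ => norm_nonneg _) ?_
    filter_upwards [eventually_ge_atTop (max R 0)] with T hT
    have hT0 : 0 ≤ T := (le_max_right _ _).trans hT
    have habs : |s * T| = T := by rw [abs_mul, hs, one_mul, abs_of_nonneg hT0]
    refine intervalIntegral.norm_integral_le_of_norm_le_const fun y hy => ?_
    rw [Set.uIoc_of_le hcd] at hy
    have := hfg ((s * T : ℝ) + y * Complex.I)
      (by simpa using ⟨hy.1.le, hy.2⟩) (by simpa [habs] using (le_max_left _ _).trans hT)
    simpa [habs] using this
  have hrect (T : ℝ) : (∫ x : ℝ in -T..T, f (x + c * Complex.I)) -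
      (∫ x : ℝ in -T..T, f (x + d * Complex.I)) =
      Complex.I * (∫ y : ℝ in c..d, f (((-1) * T : ℝ) + y * Complex.I)) -
        Complex.I * (∫ y : ℝ in c..d, f ((1 * T : ℝ) + y * Complex.I)) := by
    have := Complex.integral_boundary_rect_eq_zero_of_continuousOn_of_differentiableOn f
      ⟨-T, c⟩ ⟨T, d⟩
      (hc.mono fun z hz => by
        have h2 := hz.2
        simp only [Set.uIcc_of_le hcd] at h2
        exact h2)
      (hd.mono fun z hz => by
        have h2 := hz.2
        simp only [min_eq_left hcd, max_eq_right hcd] at h2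
        exact h2)
    simp only [smul_eq_mul] at this
    rw [neg_one_mul, one_mul]
    linear_combination this
  have hl := (intervalIntegral_tendsto_integral hic tendsto_neg_atTop_atBot tendsto_id).sub
    (intervalIntegral_tendsto_integral hid tendsto_neg_atTop_atBot tendsto_id)
  have hr := ((hside (-1) (by simp)).const_mul Complex.I).sub
    ((hside 1 (by simp)).const_mul Complex.I)
  simp only [id] at hl
  simp_rw [hrect] at hl
  have := tendsto_nhds_unique hl hr
  rw [mul_zero, sub_zero] at this
  exact sub_eq_zero.1 this

/-! ### A contour integral over the upper half-plane -/

theorem integrable_abs_rpow_mul_one_add_abs_inv :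
    Integrable fun x : ℝ => |x| ^ (-(1 / 2) : ℝ) * (1 + |x|)⁻¹ := by
  have hm : Measurable fun x : ℝ => |x| ^ (-(1 / 2) : ℝ) * (1 + |x|)⁻¹ := by fun_prop
  have hpos : IntegrableOn (fun x : ℝ => |x| ^ (-(1 / 2) : ℝ) * (1 + |x|)⁻¹) (Set.Ioi 0) := by
    rw [← Set.Ioc_union_Ioi_eq_Ioi zero_le_one, integrableOn_union]
    constructor
    · have h1 : IntegrableOn (fun y : ℝ => y ^ (-(1 / 2) : ℝ)) (Set.Ioc 0 1) := by
        rw [integrableOn_Ioc_iff_integrableOn_Ioo,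
          intervalIntegral.integrableOn_Ioo_rpow_iff one_pos]
        norm_num
      refine h1.mono' hm.aestronglyMeasurable ?_
      filter_upwards [ae_restrict_mem measurableSet_Ioc] with y hy
      have hy0 := hy.1
      rw [Real.norm_of_nonneg (by positivity), abs_of_pos hy.1]
      exact mul_le_of_le_one_right (by positivity) (inv_le_one_of_one_le₀ (by linarith))
    · have h1 : IntegrableOn (fun y : ℝ => y ^ (-(3 / 2) : ℝ)) (Set.Ioi 1) :=
        integrableOn_Ioi_rpow_of_lt (by norm_num) one_pos
      refine h1.mono' hm.aestronglyMeasurable ?_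
      filter_upwards [ae_restrict_mem measurableSet_Ioi] with y hy
      have hy0 : 0 < y := one_pos.trans hy
      rw [Real.norm_of_nonneg (by positivity), abs_of_pos hy0]
      calc y ^ (-(1 / 2) : ℝ) * (1 + y)⁻¹ ≤ y ^ (-(1 / 2) : ℝ) * y⁻¹ := by
            gcongr
            linarith
        _ = y ^ (-(3 / 2) : ℝ) := by
            rw [← Real.rpow_neg_one, ← Real.rpow_add hy0]
            norm_num
  have hneg : IntegrableOn (fun x : ℝ => |x| ^ (-(1 / 2) : ℝ) * (1 + |x|)⁻¹) (Set.Iio 0) := by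
    have := IntegrableOn.comp_neg_Iio (c := (0 : ℝ)) (μ := volume) (by rwa [neg_zero])
    simpa only [abs_neg] using this
  rw [← integrableOn_univ, ← Set.Iio_union_Ici (a := (0 : ℝ)), integrableOn_union]
  exact ⟨hneg, (integrableOn_Ici_iff_integrableOn_Ioi).2 hpos⟩

/-- Here `u` is the distance to the nearest singularity. The two other distances dominate both `m`
and `u`, hence the average `m (1 + u) / 2`. -/
theorem rpow_mul_rpow_mul_rpow_le {m u v w : ℝ} (hm : 0 < m) (hm1 : m ≤ 1) (hu : 0 < u)
    (hv : m ≤ v) (hw : m ≤ w) (huv : u ≤ v) (huw : u ≤ w) :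
    u ^ (-(1 / 2) : ℝ) * v ^ (-(1 / 2) : ℝ) * w ^ (-(1 / 2) : ℝ) ≤
      2 / m * (u ^ (-(1 / 2) : ℝ) * (1 + u)⁻¹) := by
  set n := m / 2 * (1 + u)
  have hn : 0 < n := by positivity
  have hn1 : n ≤ v := by
    have : m * u ≤ u := mul_le_of_le_one_left hu.le hm1
    simp only [n]; linarith
  have hn2 : n ≤ w := by
    have : m * u ≤ u := mul_le_of_le_one_left hu.le hm1
    simp only [n]; linarith
  calc u ^ (-(1 / 2) : ℝ) * v ^ (-(1 / 2) : ℝ) * w ^ (-(1 / 2) : ℝ)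
      ≤ u ^ (-(1 / 2) : ℝ) * n ^ (-(1 / 2) : ℝ) * n ^ (-(1 / 2) : ℝ) := by
        have e1 : v ^ (-(1 / 2) : ℝ) ≤ n ^ (-(1 / 2) : ℝ) :=
          Real.rpow_le_rpow_of_nonpos hn hn1 (by norm_num)
        have e2 : w ^ (-(1 / 2) : ℝ) ≤ n ^ (-(1 / 2) : ℝ) :=
          Real.rpow_le_rpow_of_nonpos hn hn2 (by norm_num)
        have := hn.le.trans hn2
        have := hu.le
        exact mul_le_mul (mul_le_mul_of_nonneg_left e1 (by positivity)) e2 (by positivity)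
          (by positivity)
    _ = u ^ (-(1 / 2) : ℝ) * n⁻¹ := by
        rw [mul_assoc, ← Real.rpow_add hn, ← Real.rpow_neg_one]
        norm_num
    _ = _ := by
        simp only [n]
        field_simp

/-- `|x|^{-1/2} |x - a|^{-1/2} |x - b|^{-1/2}`. -/
noncomputable def tripleSing (a b x : ℝ) : ℝ :=
  |x| ^ (-(1 / 2) : ℝ) * |x - a| ^ (-(1 / 2) : ℝ) * |x - b| ^ (-(1 / 2) : ℝ)

/-- Splitting by the nearest of the three points leaves one integrable singularity of order `1/2`,
with decay of order `3/2` at infinity. The constant `m` makes every point of the line at least `m`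
away from two of them. -/
theorem integrable_tripleSing {a b : ℝ} (h0 : 0 < a) (hab : a < b) :
    Integrable (tripleSing a b) := by
  set m := min (min (a / 2) ((b - a) / 2)) 1
  have hm : 0 < m := by simp only [m]; refine lt_min (lt_min ?_ ?_) one_pos <;> linarith
  have hm1 : m ≤ 1 := min_le_right _ _
  have hma : m ≤ a / 2 := (min_le_left _ _).trans (min_le_left _ _)
  have hmb : m ≤ (b - a) / 2 := (min_le_left _ _).trans (min_le_right _ _)
  let ψ : ℝ → ℝ := fun x => |x| ^ (-(1 / 2) : ℝ) * (1 + |x|)⁻¹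
  have hψ : Integrable ψ := integrable_abs_rpow_mul_one_add_abs_inv
  have hψ0 (x : ℝ) : 0 ≤ ψ x := by simp only [ψ]; positivity
  have hsum := ((hψ.add (hψ.comp_sub_right a)).add (hψ.comp_sub_right b)).const_mul (2 / m)
  refine hsum.mono' (Measurable.aestronglyMeasurable (by unfold tripleSing; fun_prop)) ?_
  have hne : ∀ᵐ x : ℝ, x ≠ 0 ∧ x ≠ a ∧ x ≠ b := by
    filter_upwards [Measure.ae_ne volume 0, Measure.ae_ne volume a, Measure.ae_ne volume b]
      with x h1 h2 h3 using ⟨h1, h2, h3⟩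
  filter_upwards [hne] with x ⟨hx0, hxa, hxb⟩
  have p0 : 0 < |x| := abs_pos.2 hx0
  have pa : 0 < |x - a| := abs_pos.2 (sub_ne_zero.2 hxa)
  have pb : 0 < |x - b| := abs_pos.2 (sub_ne_zero.2 hxb)
  rw [tripleSing, Real.norm_of_nonneg (by positivity)]
  have q0 := hψ0 x
  have qa := hψ0 (x - a)
  have qb := hψ0 (x - b)
  have t1 : a ≤ |x| + |x - a| := by
    have := abs_sub x (x - a); simp at this; rwa [abs_of_pos h0] at this
  have t2 : b - a ≤ |x - a| + |x - b| := by
    have := abs_sub (x - a) (x - b)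
    simp at this
    rwa [abs_of_pos (by linarith : 0 < b - a)] at this
  have t3 : b ≤ |x| + |x - b| := by
    have := abs_sub x (x - b); simp at this; rwa [abs_of_pos (h0.trans hab)] at this
  have hfin {c : ℝ} (hc : |x| ^ (-(1 / 2) : ℝ) * |x - a| ^ (-(1 / 2) : ℝ) *
      |x - b| ^ (-(1 / 2) : ℝ) ≤ 2 / m * c) (hc2 : c ≤ ψ x + ψ (x - a) + ψ (x - b)) :
      |x| ^ (-(1 / 2) : ℝ) * |x - a| ^ (-(1 / 2) : ℝ) * |x - b| ^ (-(1 / 2) : ℝ) ≤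
        2 / m * (ψ x + ψ (x - a) + ψ (x - b)) := by
    refine hc.trans ?_
    gcongr
  rcases le_total |x| |x - a| with c1 | c1
  · rcases le_total |x| |x - b| with c2 | c2
    · exact hfin (rpow_mul_rpow_mul_rpow_le hm hm1 p0 (by linarith) (by linarith) c1 c2)
        (by linarith)
    · have := rpow_mul_rpow_mul_rpow_le hm hm1 pb (v := |x|) (w := |x - a|) (by linarith)
        (by linarith) (by linarith) (by linarith)
      exact hfin (c := ψ (x - b)) (by simp only [ψ]; linarith) (by linarith)
  · rcases le_total |x - a| |x - b| with c2 | c2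
    · have := rpow_mul_rpow_mul_rpow_le hm hm1 pa (v := |x|) (w := |x - b|) (by linarith)
        (by linarith) (by linarith) (by linarith)
      exact hfin (c := ψ (x - a)) (by simp only [ψ]; linarith) (by linarith)
    · have := rpow_mul_rpow_mul_rpow_le hm hm1 pb (v := |x|) (w := |x - a|) (by linarith)
        (by linarith) (by linarith) (by linarith)
      exact hfin (c := ψ (x - b)) (by simp only [ψ]; linarith) (by linarith)

/-- The function `w ^ ν (w - a)^{-1/2} (w - b)^{-1/2}`, with principal branches. -/
noncomputable def branchFun (a b : ℝ) (ν w : ℂ) : ℂ :=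
  w ^ ν * (w - a) ^ (-(1 / 2) : ℂ) * (w - b) ^ (-(1 / 2) : ℂ)

theorem norm_cpow_neg_one_half (w : ℂ) : ‖w ^ (-(1 / 2) : ℂ)‖ = ‖w‖ ^ (-(1 / 2) : ℝ) := by
  have : (-(1 / 2) : ℂ) = ((-(1 / 2) : ℝ) : ℂ) := by push_cast; ring
  rw [this, Complex.norm_cpow_real]

theorem norm_cpow_le_exp_mul {ν : ℂ} (hν : ν.re = -(1 / 2)) {w : ℂ} (hw : w ≠ 0) :
    ‖w ^ ν‖ ≤ Real.exp (Real.pi * |ν.im|) * ‖w‖ ^ (-(1 / 2) : ℝ) := by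
  rw [Complex.norm_cpow_of_ne_zero hw, hν, div_eq_mul_inv, ← Real.exp_neg, mul_comm]
  gcongr
  refine (neg_le_abs _).trans ?_
  rw [abs_mul]
  gcongr
  exact Complex.abs_arg_le_pi w

theorem norm_branchFun_le {a b : ℝ} {ν : ℂ} (hν : ν.re = -(1 / 2)) {w : ℂ} (hw : w ≠ 0) :
    ‖branchFun a b ν w‖ ≤ Real.exp (Real.pi * |ν.im|) *
      (‖w‖ ^ (-(1 / 2) : ℝ) * ‖w - a‖ ^ (-(1 / 2) : ℝ) * ‖w - b‖ ^ (-(1 / 2) : ℝ)) := by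
  rw [branchFun, norm_mul, norm_mul, norm_cpow_neg_one_half, norm_cpow_neg_one_half]
  have := norm_cpow_le_exp_mul hν hw
  calc _ ≤ (Real.exp (Real.pi * |ν.im|) * ‖w‖ ^ (-(1 / 2) : ℝ)) *
        ‖w - a‖ ^ (-(1 / 2) : ℝ) * ‖w - b‖ ^ (-(1 / 2) : ℝ) := by gcongr
    _ = _ := by ring

theorem rpow_neg_half_le {u v : ℝ} (hu : 0 < u) (h : u ≤ v) :
    v ^ (-(1 / 2) : ℝ) ≤ u ^ (-(1 / 2) : ℝ) :=
  Real.rpow_le_rpow_of_nonpos hu h (by norm_num)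

theorem norm_branchFun_le_tripleSing {a b : ℝ} {ν : ℂ} (hν : ν.re = -(1 / 2)) {w : ℂ}
    (h0 : w.re ≠ 0) (ha : w.re ≠ a) (hb : w.re ≠ b) :
    ‖branchFun a b ν w‖ ≤ Real.exp (Real.pi * |ν.im|) * tripleSing a b w.re := by
  have hw : w ≠ 0 := by rintro rfl; simp at h0
  refine (norm_branchFun_le hν hw).trans ?_
  rw [tripleSing]
  have e0 := rpow_neg_half_le (abs_pos.2 h0) (Complex.abs_re_le_norm w)
  have ea := rpow_neg_half_le (abs_pos.2 (sub_ne_zero.2 ha))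
    (by simpa using Complex.abs_re_le_norm (w - a))
  have eb := rpow_neg_half_le (abs_pos.2 (sub_ne_zero.2 hb))
    (by simpa using Complex.abs_re_le_norm (w - b))
  gcongr

theorem differentiableAt_branchFun {a b : ℝ} {ν w : ℂ} (hw : 0 < w.im) :
    DifferentiableAt ℂ (branchFun a b ν) w := by
  have h (c : ℝ) : w - c ∈ Complex.slitPlane := Or.inr (by simpa using hw.ne')
  refine DifferentiableAt.mul (DifferentiableAt.mul ?_ ?_) ?_
  · exact differentiableAt_id.cpow_const (by simpa using h 0)
  · exact (differentiableAt_id.sub_const _).cpow_const (h a)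
  · exact (differentiableAt_id.sub_const _).cpow_const (h b)

open Filter Topology in
-- The principal logarithm is continuous from above along its cut, so boundary values from the upper
-- half-plane are the principal values on the real axis.
theorem continuousWithinAt_cpow_im_nonneg {w : ℂ} (hw : w ≠ 0) (ν : ℂ) :
    ContinuousWithinAt (fun w : ℂ => w ^ ν) {w : ℂ | 0 ≤ w.im} w := by
  by_cases h : w ∈ Complex.slitPlane
  · exact (continuousAt_cpow_const h).continuousWithinAt
  · rw [Complex.mem_slitPlane_iff, not_or, not_lt, not_not] at h
    have hre : w.re < 0 := lt_of_le_of_ne h.1 fun h' => hw (Complex.ext h' h.2)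
    have hlog := Complex.continuousWithinAt_log_of_re_neg_of_im_zero hre h.2
    have hexp : ContinuousWithinAt (fun w : ℂ => Complex.exp (Complex.log w * ν))
        {w : ℂ | 0 ≤ w.im} w := (hlog.mul continuousWithinAt_const).cexp
    refine hexp.congr_of_eventuallyEq ?_ (Complex.cpow_def_of_ne_zero hw _)
    filter_upwards [mem_nhdsWithin_of_mem_nhds (isOpen_ne.mem_nhds hw)] with v hv
    exact Complex.cpow_def_of_ne_zero hv _

open Filter Topology in
theorem tendsto_branchFun_nhdsGT {a b x : ℝ} (h0 : x ≠ 0) (ha : x ≠ a) (hb : x ≠ b) (ν : ℂ) :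
    Tendsto (fun y : ℝ => branchFun a b ν (x + y * Complex.I)) (𝓝[>] 0)
      (𝓝 (branchFun a b ν x)) := by
  have h (c : ℝ) (hc : x ≠ c) (s : ℂ) :
      Tendsto (fun y : ℝ => ((x + y * Complex.I) - c : ℂ) ^ s) (𝓝[>] 0)
        (𝓝 ((x - c : ℂ) ^ s)) := by
    have hne : (x - c : ℂ) ≠ 0 := by exact_mod_cast sub_ne_zero.2 hc
    refine (continuousWithinAt_cpow_im_nonneg hne s).tendsto.comp
      (tendsto_nhdsWithin_iff.2 ⟨?_, ?_⟩)
    · have : Continuous fun y : ℝ => ((x + y * Complex.I) - c : ℂ) := by fun_prop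
      refine (this.tendsto' 0 _ (by simp)).mono_left nhdsWithin_le_nhds
    · filter_upwards [self_mem_nhdsWithin] with y hy
      simpa using (le_of_lt hy : (0 : ℝ) ≤ y)
  have := ((h 0 h0 ν).mul (h a ha (-(1 / 2)))).mul (h b hb (-(1 / 2)))
  simpa [branchFun] using this

theorem ae_ne_three (a b : ℝ) : ∀ᵐ x : ℝ, x ≠ 0 ∧ x ≠ a ∧ x ≠ b := by
  filter_upwards [Measure.ae_ne volume 0, Measure.ae_ne volume a, Measure.ae_ne volume b]
    with x h1 h2 h3 using ⟨h1, h2, h3⟩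

theorem continuous_branchFun_line {a b : ℝ} {ν : ℂ} {y : ℝ} (hy : 0 < y) :
    Continuous fun x : ℝ => branchFun a b ν (x + y * Complex.I) := by
  refine continuous_iff_continuousAt.2 fun x => ?_
  have h := (differentiableAt_branchFun (a := a) (b := b) (ν := ν)
    (w := x + y * Complex.I) (by simpa using hy)).continuousAt
  exact ContinuousAt.comp (f := fun x : ℝ => (x + y * Complex.I : ℂ)) h (by fun_prop)

theorem integrable_branchFun_line {a b : ℝ} (h0 : 0 < a) (hab : a < b) {ν : ℂ}
    (hν : ν.re = -(1 / 2)) {y : ℝ} (hy : 0 < y) :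
    Integrable fun x : ℝ => branchFun a b ν (x + y * Complex.I) := by
  refine ((integrable_tripleSing h0 hab).const_mul (Real.exp (Real.pi * |ν.im|))).mono'
    (continuous_branchFun_line hy).aestronglyMeasurable ?_
  filter_upwards [ae_ne_three a b] with x ⟨hx0, hxa, hxb⟩
  simpa using norm_branchFun_le_tripleSing hν (w := x + y * Complex.I) (by simpa) (by simpa)
    (by simpa)

open Filter Topology in
theorem integral_branchFun_line_eq {a b : ℝ} (h0 : 0 < a) (hab : a < b) {ν : ℂ}
    (hν : ν.re = -(1 / 2)) {c d : ℝ} (hc : 0 < c) (hcd : c ≤ d) :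
    ∫ x : ℝ, branchFun a b ν (x + c * Complex.I) =
      ∫ x : ℝ, branchFun a b ν (x + d * Complex.I) := by
  have hdiff (z : ℂ) (hz : c ≤ z.im) : DifferentiableAt ℂ (branchFun a b ν) z :=
    differentiableAt_branchFun (hc.trans_le hz)
  -- For `|Re z| ≥ b + 1` both `a` and `b` are at distance at least `1`, so only the factor in `|Re
  -- z|` is kept.
  refine integral_horizontal_eq (g := fun T => Real.exp (Real.pi * |ν.im|) * T ^ (-(1 / 2) : ℝ))
    (R := b + 1) hcd
    (fun z hz => (hdiff z hz.1).continuousAt.continuousWithinAt)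
    (fun z hz => (hdiff z hz.1.le).differentiableWithinAt) ?_ (fun z hz hR => ?_)
    (integrable_branchFun_line h0 hab hν hc) (integrable_branchFun_line h0 hab hν (hc.trans_le hcd))
  · simpa using (tendsto_rpow_neg_atTop (y := 1 / 2) (by norm_num)).const_mul _
  · have hz0 : z.re ≠ 0 := by
      intro h
      rw [h, abs_zero] at hR
      linarith
    have key (p : ℝ) (hp : 0 ≤ p) (hpb : p ≤ b) : 1 ≤ |z.re - p| := by
      have := abs_sub_abs_le_abs_sub z.re p
      rw [abs_of_nonneg hp] at this
      linarith
    have ha := key a h0.le hab.le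
    have hb := key b (h0.trans hab).le le_rfl
    have hle (p : ℝ) (hp : 1 ≤ |z.re - p|) : |z.re - p| ^ (-(1 / 2) : ℝ) ≤ 1 :=
      Real.rpow_le_one_of_one_le_of_nonpos hp (by norm_num)
    refine (norm_branchFun_le_tripleSing hν hz0 ?_ ?_).trans ?_
    · rintro h
      simp [h] at ha
      linarith
    · rintro h
      simp [h] at hb
      linarith
    · rw [tripleSing, mul_assoc (|z.re| ^ _)]
      gcongr
      exact mul_le_of_le_one_right (by positivity)
        (mul_le_one₀ (hle a ha) (by positivity) (hle b hb))

open Filter Topology in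
-- The integral over `Im w = y` does not depend on `y > 0`, tends to `0` as `y → ∞`, and tends to
-- the integral over the real axis as `y → 0⁺`. Both limits are dominated by `tripleSing`, uniformly
-- in `y`.
theorem integral_branchFun_eq_zero {a b : ℝ} (h0 : 0 < a) (hab : a < b) {ν : ℂ}
    (hν : ν.re = -(1 / 2)) :
    Integrable (fun x : ℝ => branchFun a b ν x) ∧ ∫ x : ℝ, branchFun a b ν x = 0 := by
  have hD := (integrable_tripleSing h0 hab).const_mul (Real.exp (Real.pi * |ν.im|))
  have hbound (y : ℝ) : ∀ᵐ x : ℝ, ‖branchFun a b ν (x + y * Complex.I)‖ ≤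
      Real.exp (Real.pi * |ν.im|) * tripleSing a b x := by
    filter_upwards [ae_ne_three a b] with x ⟨hx0, hxa, hxb⟩
    simpa using norm_branchFun_le_tripleSing hν (w := x + y * Complex.I) (by simpa) (by simpa)
      (by simpa)
  have hmeas : AEStronglyMeasurable (fun x : ℝ => branchFun a b ν x) := by
    refine Measurable.aestronglyMeasurable ?_
    unfold branchFun
    exact (((Complex.measurable_ofReal).pow_const _).mul
      ((Complex.measurable_ofReal.sub_const _).pow_const _)).mul
      ((Complex.measurable_ofReal.sub_const _).pow_const _)
  refine ⟨hD.mono' hmeas (by simpa using hbound 0), ?_⟩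
  have hlow : Tendsto (fun y : ℝ => ∫ x : ℝ, branchFun a b ν (x + y * Complex.I)) (𝓝[>] 0)
      (𝓝 (∫ x : ℝ, branchFun a b ν x)) := by
    refine tendsto_integral_filter_of_dominated_convergence _ ?_
      (Eventually.of_forall hbound) hD ?_
    · filter_upwards [self_mem_nhdsWithin] with y hy
      exact (continuous_branchFun_line hy).aestronglyMeasurable
    · filter_upwards [ae_ne_three a b] with x ⟨hx0, hxa, hxb⟩
      exact tendsto_branchFun_nhdsGT hx0 hxa hxb ν
  have hhigh : Tendsto (fun y : ℝ => ∫ x : ℝ, branchFun a b ν (x + y * Complex.I)) atTop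
      (𝓝 0) := by
    rw [show (0 : ℂ) = ∫ _ : ℝ, (0 : ℂ) by simp]
    refine tendsto_integral_filter_of_dominated_convergence _ ?_
      (Eventually.of_forall hbound) hD ?_
    · filter_upwards [eventually_gt_atTop 0] with y hy
      exact (continuous_branchFun_line hy).aestronglyMeasurable
    · filter_upwards [ae_ne_three a b] with x ⟨hx0, hxa, hxb⟩
      rw [tendsto_zero_iff_norm_tendsto_zero]
      have hlim : Tendsto (fun y : ℝ => Real.exp (Real.pi * |ν.im|) * (y ^ (-(1 / 2) : ℝ) *
          |x - a| ^ (-(1 / 2) : ℝ) * |x - b| ^ (-(1 / 2) : ℝ))) atTop (𝓝 0) := by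
        simpa using (((tendsto_rpow_neg_atTop (y := 1 / 2) (by norm_num)).mul_const
          (|x - a| ^ (-(1 / 2) : ℝ))).mul_const (|x - b| ^ (-(1 / 2) : ℝ))).const_mul
          (Real.exp (Real.pi * |ν.im|))
      refine tendsto_of_tendsto_of_tendsto_of_le_of_le' tendsto_const_nhds hlim
        (Eventually.of_forall fun _ => norm_nonneg _) ?_
      filter_upwards [eventually_gt_atTop 0] with y hy
      have hw : (x + y * Complex.I : ℂ) ≠ 0 := fun h => hy.ne' (by simpa using congrArg Complex.im h)
      refine (norm_branchFun_le hν hw).trans ?_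
      have e0 := rpow_neg_half_le hy (v := ‖(x + y * Complex.I : ℂ)‖)
        (by simpa [abs_of_pos hy] using Complex.abs_im_le_norm (x + y * Complex.I))
      have ea := rpow_neg_half_le (abs_pos.2 (sub_ne_zero.2 hxa)) (v := ‖(x + y * Complex.I - a : ℂ)‖)
        (by simpa using Complex.abs_re_le_norm (x + y * Complex.I - a))
      have eb := rpow_neg_half_le (abs_pos.2 (sub_ne_zero.2 hxb)) (v := ‖(x + y * Complex.I - b : ℂ)‖)
        (by simpa using Complex.abs_re_le_norm (x + y * Complex.I - b))
      have := hy.le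
      gcongr
  have hconst (y : ℝ) (hy : 0 < y) : ∫ x : ℝ, branchFun a b ν (x + y * Complex.I) = 0 := by
    refine tendsto_nhds_unique (tendsto_const_nhds.congr' ?_) hhigh
    filter_upwards [eventually_ge_atTop y] with d hd
    exact integral_branchFun_line_eq h0 hab hν hy hd
  refine tendsto_nhds_unique hlow (tendsto_const_nhds.congr' ?_)
  filter_upwards [self_mem_nhdsWithin] with y hy
  exact (hconst y hy).symm

/-! ### The connection formula between `P` and `Q` -/

theorem cpow_neg_one_half_of_neg {r : ℝ} (hr : r < 0) :
    (r : ℂ) ^ (-(1 / 2) : ℂ) = -Complex.I * (√(-r) : ℂ)⁻¹ := by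
  have e : Complex.exp (Real.pi * Complex.I * (-(1 / 2))) = -Complex.I := by
    rw [show (Real.pi * Complex.I * (-(1 / 2)) : ℂ) = -(Real.pi / 2 * Complex.I) by ring,
      Complex.exp_neg, Complex.exp_pi_div_two_mul_I, Complex.inv_I]
  rw [Complex.ofReal_cpow_of_nonpos hr.le, e, ← Complex.ofReal_neg,
    cpow_neg_one_half (by linarith)]
  ring

/-- The integral of `x ^ ν r(x)` over `S`. -/
noncomputable def powIntegral (S : Set ℝ) (r : ℝ → ℝ) (ν : ℂ) : ℂ :=
  ∫ x in S, (x : ℂ) ^ ν * ((r x : ℝ) : ℂ)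

theorem conj_powIntegral {S : Set ℝ} (hS : MeasurableSet S) (hpos : S ⊆ Set.Ioi 0) (r : ℝ → ℝ)
    (ν : ℂ) : starRingEnd ℂ (powIntegral S r (starRingEnd ℂ ν)) = powIntegral S r ν := by
  rw [powIntegral, ← integral_conj, powIntegral]
  refine setIntegral_congr_fun hS fun x hx => ?_
  have hx0 : 0 < x := hpos hx
  have harg : (x : ℂ).arg ≠ Real.pi := by
    rw [Complex.arg_ofReal_of_nonneg hx0.le]
    exact Real.pi_pos.ne
  simp only [map_mul, Complex.conj_ofReal]
  rw [Complex.cpow_conj _ _ harg, Complex.conj_ofReal]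
  simp

/-- The vanishing integral is cut at `0`, `a`, `b`: each negative factor `(x - a)^{-1/2}` or `(x -
b)^{-1/2}` contributes `-i`, and the negative axis also gives `e^{iπν}`. -/
theorem powIntegral_relation {a b : ℝ} (h0 : 0 < a) (hab : a < b) {ν : ℂ}
    (hν : ν.re = -(1 / 2)) :
    powIntegral (Set.Ioi b) (fun x => (√((x - a) * (x - b)))⁻¹) ν -
      Complex.I * powIntegral (Set.Ioo a b) (fun x => (√((x - a) * (b - x)))⁻¹) ν -
      powIntegral (Set.Ioo 0 a) (fun x => (√((a - x) * (b - x)))⁻¹) ν -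
      Complex.exp (Real.pi * Complex.I * ν) *
        powIntegral (Set.Ioi 0) (fun x => (√((x + a) * (x + b)))⁻¹) ν = 0 := by
  obtain ⟨h_int, hzero⟩ := integral_branchFun_eq_zero h0 hab hν
  have hb0 : 0 < b := h0.trans hab
  have p3 : ∫ x in Set.Ioi b, branchFun a b ν x =
      powIntegral (Set.Ioi b) (fun x => (√((x - a) * (x - b)))⁻¹) ν := by
    refine setIntegral_congr_fun measurableSet_Ioi fun x hx => ?_
    have hx' : b < x := hx
    simp only [branchFun]
    rw [← Complex.ofReal_sub, ← Complex.ofReal_sub, cpow_neg_one_half (by linarith),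
      cpow_neg_one_half (by linarith), Real.sqrt_mul (by linarith)]
    push_cast
    rw [mul_inv]
    ring
  have p2 : ∫ x in Set.Ioc a b, branchFun a b ν x =
      -Complex.I * powIntegral (Set.Ioo a b) (fun x => (√((x - a) * (b - x)))⁻¹) ν := by
    rw [powIntegral, ← integral_const_mul, integral_Ioc_eq_integral_Ioo]
    refine setIntegral_congr_fun measurableSet_Ioo fun x hx => ?_
    simp only [branchFun]
    rw [← Complex.ofReal_sub, ← Complex.ofReal_sub, cpow_neg_one_half (by linarith [hx.1]),
      cpow_neg_one_half_of_neg (by linarith [hx.2]), Real.sqrt_mul (by linarith [hx.1]), neg_sub]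
    push_cast
    rw [mul_inv]
    ring
  have p1 : ∫ x in Set.Ioc 0 a, branchFun a b ν x =
      -powIntegral (Set.Ioo 0 a) (fun x => (√((a - x) * (b - x)))⁻¹) ν := by
    rw [powIntegral, ← integral_neg, integral_Ioc_eq_integral_Ioo]
    refine setIntegral_congr_fun measurableSet_Ioo fun x hx => ?_
    simp only [branchFun]
    rw [← Complex.ofReal_sub, ← Complex.ofReal_sub, cpow_neg_one_half_of_neg (by linarith [hx.2]),
      cpow_neg_one_half_of_neg (by linarith [hx.2]), Real.sqrt_mul (by linarith [hx.2]), neg_sub,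
      neg_sub]
    push_cast
    rw [mul_inv]
    linear_combination ((x : ℂ) ^ ν * (√(a - x) : ℂ)⁻¹ * (√(b - x) : ℂ)⁻¹) * Complex.I_sq
  have p0 : ∫ x in Set.Iic (0 : ℝ), branchFun a b ν x = -(Complex.exp (Real.pi * Complex.I * ν) *
      powIntegral (Set.Ioi 0) (fun x => (√((x + a) * (x + b)))⁻¹) ν) := by
    have := integral_comp_neg_Ioi 0 (fun x : ℝ => branchFun a b ν x)
    rw [neg_zero] at this
    rw [← this, powIntegral, ← integral_const_mul, ← integral_neg]
    refine setIntegral_congr_fun measurableSet_Ioi fun x hx => ?_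
    have hx' : 0 < x := hx
    simp only [branchFun]
    rw [← Complex.ofReal_sub, ← Complex.ofReal_sub, cpow_neg_one_half_of_neg (by linarith),
      cpow_neg_one_half_of_neg (by linarith), Complex.ofReal_cpow_of_nonpos (by linarith),
      show -(-x - a) = x + a by ring, show -(-x - b) = x + b by ring,
      Real.sqrt_mul (by linarith)]
    push_cast
    rw [mul_inv, neg_neg]
    linear_combination ((x : ℂ) ^ ν * Complex.exp (Real.pi * Complex.I * ν) *
      (√(x + a) : ℂ)⁻¹ * (√(x + b) : ℂ)⁻¹) * Complex.I_sq
  have s1 := intervalIntegral.integral_Iic_add_Ioi (b := 0) h_int.integrableOn h_int.integrableOn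
  have s2 : ∫ x in Set.Ioi (0 : ℝ), branchFun a b ν x =
      (∫ x in Set.Ioc 0 a, branchFun a b ν x) + ∫ x in Set.Ioi a, branchFun a b ν x := by
    rw [← Set.Ioc_union_Ioi_eq_Ioi h0.le, setIntegral_union
      (Set.Ioc_disjoint_Ioi le_rfl) measurableSet_Ioi h_int.integrableOn h_int.integrableOn]
  have s3 : ∫ x in Set.Ioi a, branchFun a b ν x =
      (∫ x in Set.Ioc a b, branchFun a b ν x) + ∫ x in Set.Ioi b, branchFun a b ν x := by
    rw [← Set.Ioc_union_Ioi_eq_Ioi hab.le, setIntegral_union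
      (Set.Ioc_disjoint_Ioi le_rfl) measurableSet_Ioi h_int.integrableOn h_int.integrableOn]
  rw [s2, s3, p0, p1, p2, p3, hzero] at s1
  linear_combination s1

/-- The inversion `x ↦ x⁻¹` exchanges `(a⁻¹, ∞)` with `(0, a)` and preserves the pair of branch
points. -/
theorem powIntegral_Ioi_eq_legendreQ {a : ℝ} (h0 : 0 < a) (h1 : a < 1) (ν : ℂ) :
    powIntegral (Set.Ioi a⁻¹) (fun x => (√((x - a) * (x - a⁻¹)))⁻¹) ν = legendreQ a (-ν) := by
  have himg : (fun x : ℝ => x⁻¹) '' Set.Ioo 0 a = Set.Ioi a⁻¹ := by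
    ext y
    constructor
    · rintro ⟨x, hx, rfl⟩
      exact (inv_lt_inv₀ h0 hx.1).2 hx.2
    · intro hy
      have hy' : a⁻¹ < y := hy
      have hy0 : 0 < y := (inv_pos.2 h0).trans hy'
      exact ⟨y⁻¹, ⟨inv_pos.2 hy0, inv_lt_of_inv_lt₀ h0 hy'⟩, inv_inv y⟩
  rw [powIntegral, legendreQ, ← himg, integral_image_eq_integral_abs_deriv_smul measurableSet_Ioo
    (fun x hx => (hasDerivAt_inv hx.1.ne').hasDerivWithinAt) inv_injective.injOn]
  refine setIntegral_congr_fun measurableSet_Ioo fun x hx => ?_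
  have hx0 := hx.1
  have hxc : (x : ℂ) ≠ 0 := by exact_mod_cast hx0.ne'
  have h2 : 1 < a⁻¹ := (one_lt_inv₀ h0).2 h1
  have e1 : (x⁻¹ - a) * (x⁻¹ - a⁻¹) = (a - x) * (a⁻¹ - x) / x ^ 2 := by
    field_simp
  have e2 : √((x⁻¹ - a) * (x⁻¹ - a⁻¹)) = √((a - x) * (a⁻¹ - x)) / x := by
    rw [e1, Real.sqrt_div (mul_nonneg (by linarith [hx.2]) (by linarith [hx.2])),
      Real.sqrt_sq hx0.le]
  rw [e2, abs_neg, abs_of_pos (by positivity), Complex.real_smul, Complex.ofReal_inv x,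
    Complex.inv_cpow _ _ (by rw [Complex.arg_ofReal_of_nonneg hx0.le]; exact Real.pi_pos.ne),
    Complex.cpow_sub _ _ hxc, Complex.cpow_neg, Complex.cpow_one]
  push_cast
  field_simp

theorem powIntegral_Ioo_eq_legendreQ (a : ℝ) (ν : ℂ) :
    powIntegral (Set.Ioo 0 a) (fun x => (√((a - x) * (a⁻¹ - x)))⁻¹) ν = legendreQ a (ν + 1) := by
  simp [powIntegral, legendreQ, div_eq_mul_inv]

/-- The substitution `y = x + √(x² - 1) cos φ` onto `(a, a⁻¹)` recovers Laplace's integral. -/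
theorem powIntegral_Ioo_eq_legendreP {a : ℝ} (h0 : 0 < a) (h1 : a < 1) (ν : ℂ) :
    powIntegral (Set.Ioo a a⁻¹) (fun x => (√((x - a) * (a⁻¹ - x)))⁻¹) ν =
      Real.pi * legendreP ν (joukowski a) := by
  have h2 : 1 < a⁻¹ := (one_lt_inv₀ h0).2 h1
  have hpi : (Real.pi : ℂ) ≠ 0 := by exact_mod_cast Real.pi_ne_zero
  set ρ := (a⁻¹ - a) / 2 with hρdef
  have hρ : 0 < ρ := by rw [hρdef]; linarith
  have hsq : √(joukowski a ^ 2 - 1) = ρ := by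
    rw [show joukowski a ^ 2 - 1 = ρ ^ 2 by rw [joukowski, hρdef]; field_simp; ring,
      Real.sqrt_sq hρ.le]
  have hJa : joukowski a - ρ = a := by rw [joukowski, hρdef]; ring
  have hJb : joukowski a + ρ = a⁻¹ := by rw [joukowski, hρdef]; ring
  rw [legendreP, ← mul_assoc, mul_inv_cancel₀ hpi, one_mul, hsq,
    intervalIntegral.integral_of_le Real.pi_pos.le, integral_Ioc_eq_integral_Ioo]
  have hcos (φ : ℝ) (hφ : φ ∈ Set.Ioo 0 Real.pi) : Real.cos φ ∈ Set.Ioo (-1) 1 := by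
    have hs := Real.sin_pos_of_mem_Ioo hφ
    have := Real.sin_sq_add_cos_sq φ
    constructor <;> nlinarith
  have himg : (fun φ : ℝ => joukowski a + ρ * Real.cos φ) '' Set.Ioo 0 Real.pi =
      Set.Ioo a a⁻¹ := by
    ext y
    constructor
    · rintro ⟨φ, hφ, rfl⟩
      have := hcos φ hφ
      constructor
      · nlinarith [this.1]
      · nlinarith [this.2]
    · intro hy
      have c1 : -1 < (y - joukowski a) / ρ := by rw [lt_div_iff₀ hρ]; linarith [hy.1]
      have c2 : (y - joukowski a) / ρ < 1 := by rw [div_lt_one hρ]; linarith [hy.2]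
      refine ⟨Real.arccos ((y - joukowski a) / ρ), ⟨Real.arccos_pos.2 c2, ?_⟩, ?_⟩
      · refine lt_of_le_of_ne (Real.arccos_le_pi _) fun h => ?_
        rw [Real.arccos_eq_pi] at h
        linarith
      · simp only
        rw [Real.cos_arccos c1.le c2.le]
        field_simp
        ring
  have hinj : Set.InjOn (fun φ : ℝ => joukowski a + ρ * Real.cos φ) (Set.Ioo 0 Real.pi) := by
    intro x hx y hy h
    have : Real.cos x = Real.cos y := mul_left_cancel₀ hρ.ne' (add_left_cancel h)
    exact Real.injOn_cos ⟨hx.1.le, hx.2.le⟩ ⟨hy.1.le, hy.2.le⟩ this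
  rw [powIntegral, ← himg, integral_image_eq_integral_abs_deriv_smul measurableSet_Ioo
    (fun φ _ => (((Real.hasDerivAt_cos φ).const_mul ρ).const_add _).hasDerivWithinAt) hinj]
  refine setIntegral_congr_fun measurableSet_Ioo fun φ hφ => ?_
  have hs := Real.sin_pos_of_mem_Ioo hφ
  have e : (joukowski a + ρ * Real.cos φ - a) * (a⁻¹ - (joukowski a + ρ * Real.cos φ)) =
      (ρ * Real.sin φ) ^ 2 := by
    rw [← hJb]
    nth_rewrite 2 [← hJa]
    have := Real.sin_sq_add_cos_sq φ
    linear_combination (-ρ ^ 2) * this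
  rw [e, Real.sqrt_sq (by positivity), mul_neg, abs_neg, abs_of_pos (by positivity),
    Complex.real_smul, mul_left_comm, ← Complex.ofReal_mul, mul_inv_cancel₀ (by positivity),
    Complex.ofReal_one, mul_one]

theorem legendreQ_sub_legendreQ {a : ℝ} (h0 : 0 < a) (h1 : a < 1) (t : ℝ) :
    legendreQ a (1 / 2 - Complex.I * t) - legendreQ a (1 / 2 + Complex.I * t) =
      Complex.I * Real.pi * Real.tanh (Real.pi * t) *
        legendreP (-1 / 2 + Complex.I * t) (joukowski a) := by
  have h2 : 1 < a⁻¹ := (one_lt_inv₀ h0).2 h1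
  have hab : a < a⁻¹ := h1.trans h2
  set ν : ℂ := -1 / 2 + Complex.I * t with hν
  have hre : ν.re = -(1 / 2) := by simp [hν]; norm_num
  have hre' : (starRingEnd ℂ ν).re = -(1 / 2) := by simpa using hre
  have r1 := powIntegral_relation h0 hab hre
  -- Conjugating the relation at `conj ν` gives the relation that a contour in the lower half-plane
  -- would give.
  have r2 := congrArg (starRingEnd ℂ) (powIntegral_relation h0 hab hre')
  simp only [map_sub, map_mul, map_zero, Complex.conj_I, ← Complex.exp_conj, Complex.conj_ofReal,
    Complex.conj_conj] at r2
  rw [conj_powIntegral measurableSet_Ioi (Set.Ioi_subset_Ioi (by linarith)),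
    conj_powIntegral measurableSet_Ioo fun x hx => h0.trans hx.1,
    conj_powIntegral measurableSet_Ioo fun x hx => hx.1,
    conj_powIntegral measurableSet_Ioi subset_rfl] at r2
  rw [powIntegral_Ioi_eq_legendreQ h0 h1, powIntegral_Ioo_eq_legendreQ,
    powIntegral_Ioo_eq_legendreP h0 h1] at r1 r2
  have e1 : Complex.exp (Real.pi * Complex.I * ν) = -Complex.I * (Real.exp (-(Real.pi * t)) : ℂ) := by
    rw [show (Real.pi * Complex.I * ν : ℂ) = -(Real.pi / 2 * Complex.I) + -(Real.pi * t) by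
      rw [hν]; linear_combination (Real.pi * t : ℂ) * Complex.I_sq, Complex.exp_add,
      Complex.exp_neg, Complex.exp_pi_div_two_mul_I, Complex.inv_I]
    push_cast
    ring
  have e2 : Complex.exp (Real.pi * -Complex.I * ν) = Complex.I * (Real.exp (Real.pi * t) : ℂ) := by
    rw [show (Real.pi * -Complex.I * ν : ℂ) = (Real.pi / 2 * Complex.I) + (Real.pi * t) by
      rw [hν]; linear_combination (-Real.pi * t : ℂ) * Complex.I_sq, Complex.exp_add,
      Complex.exp_pi_div_two_mul_I]
    push_cast
    ring
  rw [e1] at r1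
  rw [e2] at r2
  rw [show (1 / 2 - Complex.I * t : ℂ) = -ν by rw [hν]; ring,
    show (1 / 2 + Complex.I * t : ℂ) = ν + 1 by rw [hν]; ring]
  have hc : (Real.cosh (Real.pi * t) : ℂ) ≠ 0 := by exact_mod_cast (Real.cosh_pos _).ne'
  have hexp : (Real.exp (Real.pi * t) : ℂ) * (Real.exp (-(Real.pi * t)) : ℂ) = 1 := by
    rw [← Complex.ofReal_mul, ← Real.exp_add, add_neg_cancel, Real.exp_zero, Complex.ofReal_one]
  rw [Real.tanh_eq_sinh_div_cosh, Complex.ofReal_div]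
  have hC : (Real.cosh (Real.pi * t) : ℂ) =
      ((Real.exp (Real.pi * t) : ℂ) + (Real.exp (-(Real.pi * t)) : ℂ)) / 2 := by
    rw [Real.cosh_eq]; push_cast; ring
  have hS : (Real.sinh (Real.pi * t) : ℂ) =
      ((Real.exp (Real.pi * t) : ℂ) - (Real.exp (-(Real.pi * t)) : ℂ)) / 2 := by
    rw [Real.sinh_eq]; push_cast; ring
  rw [← mul_div_assoc, div_mul_eq_mul_div, eq_div_iff hc, hC, hS]
  -- The weights `e^{±πt}` eliminate the integral over the negative axis and leave `2 cosh(πt)` on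
  -- `Q` and `2 sinh(πt)` on `P`.
  linear_combination (Real.exp (Real.pi * t) / 2 : ℂ) * r1 +
    (Real.exp (-(Real.pi * t)) / 2 : ℂ) * r2

/-! ### The spectral integral of a single group element -/

theorem isClosed_strip (ε : ℝ) : IsClosed (strip ε) :=
  isClosed_le (continuous_abs.comp Complex.continuous_im) continuous_const

open Filter in
-- The part of the closed strip on which the asymptotic bound may fail lies in a compact set, where
-- `h` is bounded.
theorem exists_norm_le_of_isBigO_strip {h : ℂ → ℂ} {ε : ℝ} (hc : ContinuousOn h (strip ε))
    (hbound : h =O[Bornology.cobounded ℂ ⊓ principal (strip ε)]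
      fun r : ℂ => (1 + ‖r‖) ^ (-2 : ℤ)) :
    ∃ C, 0 ≤ C ∧ ∀ r ∈ strip ε, ‖h r‖ ≤ C * (1 + ‖r‖) ^ (-2 : ℤ) := by
  obtain ⟨c, hc0, hcb⟩ := hbound.exists_nonneg
  rw [Asymptotics.IsBigOWith, eventually_inf_principal] at hcb
  obtain ⟨R, -, hR⟩ := (Metric.hasBasis_cobounded_compl_closedBall (0 : ℂ)).eventually_iff.1 hcb
  have hcomp : IsCompact (strip ε ∩ Metric.closedBall 0 R) :=
    (isCompact_closedBall 0 R).inter_left (isClosed_strip ε)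
  obtain ⟨M, hM⟩ := hcomp.exists_bound_of_continuousOn (hc.mono Set.inter_subset_left)
  refine ⟨c + |M| * (1 + |R|) ^ 2, by positivity, fun r hr => ?_⟩
  have hpos : 0 < (1 + ‖r‖) ^ (-2 : ℤ) := by positivity
  by_cases hrR : r ∈ Metric.closedBall 0 R
  · have h1 : ‖h r‖ ≤ |M| := (hM r ⟨hr, hrR⟩).trans (le_abs_self M)
    have h2 : ‖r‖ ≤ |R| := (mem_closedBall_zero_iff.1 hrR).trans (le_abs_self R)
    have h3 : 1 ≤ (1 + |R|) ^ 2 * (1 + ‖r‖) ^ (-2 : ℤ) := by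
      rw [zpow_neg, ← div_eq_mul_inv, one_le_div (by positivity)]
      norm_cast
      gcongr
    calc ‖h r‖ ≤ |M| * 1 := by rwa [mul_one]
      _ ≤ |M| * ((1 + |R|) ^ 2 * (1 + ‖r‖) ^ (-2 : ℤ)) := by gcongr
      _ ≤ _ := by nlinarith
  · have h1 := hR hrR hr
    rw [Real.norm_of_nonneg hpos.le] at h1
    refine h1.trans ?_
    gcongr
    have : 0 ≤ |M| * (1 + |R|) ^ 2 := by positivity
    linarith

/-- The function `r h(r) Q_{-1/2+ir}((a + a⁻¹) / 2)`. -/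
noncomputable def spectralFun (h : ℂ → ℂ) (a : ℝ) (r : ℂ) : ℂ :=
  r * h r * legendreQ a (1 / 2 + Complex.I * r)

theorem mem_strip_of_im_mem_Icc {ε δ : ℝ} (hδ : 0 < δ) (hδε : δ ≤ ε) {r : ℂ}
    (hr : r.im ∈ Set.Icc (-(1 / 2 + δ)) 0) : r ∈ strip ε := by
  have : |r.im| ≤ 1 / 2 + ε := abs_le.2 ⟨by linarith [hr.1], by linarith [hr.2]⟩
  exact this

/-- The exponent `3/2` is `-1 + 2 + 1/2`, from `r`, `h(r)` and the `|μ|^{-1/2}` decay of `Q`; that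
last half is what makes the integral converge absolutely. The constant is uniform in `a ≤ a₀`, as
the sum over `Γ` requires. -/
theorem exists_norm_spectralFun_le {h : ℂ → ℂ} {ε δ C : ℝ} (hδ : 0 < δ) (hδε : δ ≤ ε)
    (hC0 : 0 ≤ C) (hC : ∀ r ∈ strip ε, ‖h r‖ ≤ C * (1 + ‖r‖) ^ (-2 : ℤ)) {a₀ : ℝ} (ha₀ : a₀ < 1) :
    ∃ C', 0 ≤ C' ∧ ∀ a, 0 < a → a ≤ a₀ → ∀ r : ℂ, r.im ∈ Set.Icc (-(1 / 2 + δ)) 0 →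
      ‖spectralFun h a r‖ ≤ C' * a ^ (1 / 2 - r.im) * (1 + |r.re|) ^ (-(3 / 2) : ℝ) := by
  obtain ⟨D, hD0, hD⟩ := exists_norm_legendreQ_le (σ := 1 / 2) (by norm_num) ha₀
  refine ⟨2 * C * D, by positivity, fun a h0 ha r hr => ?_⟩
  have hre : (1 / 2 + Complex.I * r).re = 1 / 2 - r.im := by simp; ring
  have h1 := hD a h0 ha (1 / 2 + Complex.I * r) (by rw [hre]; linarith [hr.2])
  rw [hre] at h1
  have h2 := hC r (mem_strip_of_im_mem_Icc hδ hδε hr)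
  set μ := 1 / 2 + Complex.I * r
  have hμ : 1 / 2 ≤ ‖μ‖ := by
    refine le_trans ?_ (Complex.re_le_norm μ)
    rw [hre]
    linarith [hr.2]
  have hr1 : ‖r‖ ≤ ‖μ‖ + 1 / 2 := by
    have : Complex.I * r = μ - 1 / 2 := by simp [μ]
    calc ‖r‖ = ‖Complex.I * r‖ := by simp
      _ ≤ ‖μ‖ + ‖(1 / 2 : ℂ)‖ := by rw [this]; exact norm_sub_le _ _
      _ = _ := by norm_num
  have hs : 0 < 1 + ‖r‖ := by positivity
  have h3 : (√‖μ‖)⁻¹ ≤ 2 * (1 + ‖r‖) ^ (-(1 / 2) : ℝ) := by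
    rw [Real.rpow_neg hs.le, ← Real.sqrt_eq_rpow, ← div_eq_mul_inv, inv_le_comm₀ (by positivity)
      (by positivity), inv_div, div_le_iff₀ (by norm_num)]
    calc √(1 + ‖r‖) ≤ √(‖μ‖ * 2 ^ 2) := Real.sqrt_le_sqrt (by linarith)
      _ = √‖μ‖ * 2 := by rw [Real.sqrt_mul (norm_nonneg _), Real.sqrt_sq (by norm_num)]
  have h4 : (1 + ‖r‖) * (1 + ‖r‖) ^ (-2 : ℤ) * (1 + ‖r‖) ^ (-(1 / 2) : ℝ) =
      (1 + ‖r‖) ^ (-(3 / 2) : ℝ) := by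
    rw [← Real.rpow_intCast]
    nth_rewrite 1 [← Real.rpow_one (1 + ‖r‖)]
    rw [← Real.rpow_add hs, ← Real.rpow_add hs]
    norm_num
  have h5 : (1 + ‖r‖) ^ (-(3 / 2) : ℝ) ≤ (1 + |r.re|) ^ (-(3 / 2) : ℝ) :=
    Real.rpow_le_rpow_of_nonpos (by positivity)
      (by linarith [Complex.abs_re_le_norm r]) (by norm_num)
  rw [spectralFun, norm_mul, norm_mul]
  calc ‖r‖ * ‖h r‖ * ‖legendreQ a μ‖
      ≤ (1 + ‖r‖) * (C * (1 + ‖r‖) ^ (-2 : ℤ)) * (D * a ^ (1 / 2 - r.im) * (√‖μ‖)⁻¹) := by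
        gcongr
        · linarith
        · exact h1.trans_eq (div_eq_mul_inv _ _)
    _ ≤ (1 + ‖r‖) * (C * (1 + ‖r‖) ^ (-2 : ℤ)) *
        (D * a ^ (1 / 2 - r.im) * (2 * (1 + ‖r‖) ^ (-(1 / 2) : ℝ))) := by gcongr
    _ = 2 * C * D * a ^ (1 / 2 - r.im) *
        ((1 + ‖r‖) * (1 + ‖r‖) ^ (-2 : ℤ) * (1 + ‖r‖) ^ (-(1 / 2) : ℝ)) := by ring
    _ ≤ _ := by
        rw [h4]
        gcongr

theorem differentiableOn_spectralFun {h : ℂ → ℂ} {ε δ a : ℝ} (hd : DifferentiableOn ℂ h (strip ε))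
    (hδ : 0 < δ) (hδε : δ ≤ ε) (h0 : 0 < a) (h1 : a < 1) :
    DifferentiableOn ℂ (spectralFun h a) {r | r.im ∈ Set.Icc (-(1 / 2 + δ)) 0} := by
  refine DifferentiableOn.mul (differentiableOn_id.mul
    (hd.mono fun r hr => mem_strip_of_im_mem_Icc hδ hδε hr)) ?_
  -- On `Im r ≤ 0` one has `Re (1/2 + ir) ≥ 1/2`; any `σ < 1/2` puts this closed region inside the
  -- open half-plane.
  refine (differentiableOn_legendreQ h0 h1 (σ := 1 / 4) (by norm_num)).comp
    (f := fun r : ℂ => 1 / 2 + Complex.I * r) (by fun_prop) fun r hr => ?_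
  have := hr.2
  simp
  linarith

theorem integrable_one_add_abs_rpow :
    Integrable fun x : ℝ => (1 + |x|) ^ (-(3 / 2) : ℝ) := by
  simpa using integrable_one_add_norm (E := ℝ) (μ := volume) (r := 3 / 2) (by norm_num)

theorem continuous_spectralFun_line {h : ℂ → ℂ} {ε δ a : ℝ}
    (hd : DifferentiableOn ℂ h (strip ε)) (hδ : 0 < δ) (hδε : δ ≤ ε) (h0 : 0 < a) (h1 : a < 1)
    {y : ℝ} (hy : y ∈ Set.Icc (-(1 / 2 + δ)) 0) :
    Continuous fun x : ℝ => spectralFun h a (x + y * Complex.I) := by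
  rw [← continuousOn_univ]
  refine (differentiableOn_spectralFun hd hδ hδε h0 h1).continuousOn.comp
    (f := fun x : ℝ => (x + y * Complex.I : ℂ)) (by fun_prop) fun x _ => ?_
  simpa using hy

theorem integrable_spectralFun_line {h : ℂ → ℂ} {ε δ a C : ℝ}
    (hd : DifferentiableOn ℂ h (strip ε)) (hδ : 0 < δ) (hδε : δ ≤ ε) (h0 : 0 < a) (h1 : a < 1)
    (hC0 : 0 ≤ C) (hC : ∀ r ∈ strip ε, ‖h r‖ ≤ C * (1 + ‖r‖) ^ (-2 : ℤ))
    {y : ℝ} (hy : y ∈ Set.Icc (-(1 / 2 + δ)) 0) :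
    Integrable fun x : ℝ => spectralFun h a (x + y * Complex.I) := by
  obtain ⟨C', -, hC'⟩ := exists_norm_spectralFun_le hδ hδε hC0 hC h1
  refine (integrable_one_add_abs_rpow.const_mul (C' * a ^ (1 / 2 - y))).mono'
    (continuous_spectralFun_line hd hδ hδε h0 h1 hy).aestronglyMeasurable
    (Filter.Eventually.of_forall fun x => ?_)
  simpa using hC' a h0 le_rfl (x + y * Complex.I) (by simpa using hy)

open Filter Topology in
theorem integral_spectralFun_shift {h : ℂ → ℂ} {ε δ a C : ℝ}
    (hd : DifferentiableOn ℂ h (strip ε)) (hδ : 0 < δ) (hδε : δ ≤ ε) (h0 : 0 < a) (h1 : a < 1)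
    (hC0 : 0 ≤ C) (hC : ∀ r ∈ strip ε, ‖h r‖ ≤ C * (1 + ‖r‖) ^ (-2 : ℤ)) :
    ∫ x : ℝ, spectralFun h a (x + (-(1 / 2 + δ) : ℝ) * Complex.I) =
      ∫ x : ℝ, spectralFun h a x := by
  have hle : -(1 / 2 + δ) ≤ 0 := by linarith
  obtain ⟨C', hC'0, hC'⟩ := exists_norm_spectralFun_le hδ hδε hC0 hC h1
  have hdiff := differentiableOn_spectralFun hd hδ hδε h0 h1
  have := integral_horizontal_eq (f := spectralFun h a)
    (g := fun T => C' * (1 + T) ^ (-(3 / 2) : ℝ)) (R := 0) hle hdiff.continuousOn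
    (hdiff.mono fun r hr => ⟨hr.1.le, hr.2.le⟩) ?_ (fun r hr _ => ?_)
    (integrable_spectralFun_line hd hδ hδε h0 h1 hC0 hC ⟨le_rfl, hle⟩)
    (integrable_spectralFun_line hd hδ hδε h0 h1 hC0 hC ⟨hle, le_rfl⟩)
  · simpa using this
  · simpa using ((tendsto_rpow_neg_atTop (y := 3 / 2) (by norm_num)).comp
      (tendsto_atTop_add_const_left _ (1 : ℝ) tendsto_id)).const_mul C'
  · refine (hC' a h0 le_rfl r hr).trans ?_
    have : a ^ (1 / 2 - r.im) ≤ 1 := Real.rpow_le_one h0.le h1.le (by linarith [hr.2])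
    gcongr
    exact mul_le_of_le_one_right hC'0 this

/-- By the connection formula and the evenness of `h`, the integrand is `i/π` times `spectralFun` at
`r` plus at `-r`; both halves have the same integral. -/
theorem integral_legendreP_eq {h : ℂ → ℂ} {ε δ a C : ℝ}
    (heven : ∀ r ∈ strip ε, h (-r) = h r)
    (hd : DifferentiableOn ℂ h (strip ε)) (hδ : 0 < δ) (hδε : δ ≤ ε) (h0 : 0 < a) (h1 : a < 1)
    (hC0 : 0 ≤ C) (hC : ∀ r ∈ strip ε, ‖h r‖ ≤ C * (1 + ‖r‖) ^ (-2 : ℤ)) :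
    ∫ r : ℝ, (r * Real.tanh (Real.pi * r) : ℂ) * h r *
        legendreP (-1 / 2 + Complex.I * r) (joukowski a) =
      2 * Complex.I / Real.pi * ∫ x : ℝ, spectralFun h a x := by
  have hpi : (Real.pi : ℂ) ≠ 0 := by exact_mod_cast Real.pi_ne_zero
  have h_int : Integrable fun x : ℝ => spectralFun h a x := by
    simpa using integrable_spectralFun_line hd hδ hδε h0 h1 hC0 hC (y := 0)
      ⟨by linarith, le_rfl⟩
  have hpt (r : ℝ) : (r * Real.tanh (Real.pi * r) : ℂ) * h r *
      legendreP (-1 / 2 + Complex.I * r) (joukowski a) =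
      Complex.I / Real.pi * (spectralFun h a r + spectralFun h a ((-r : ℝ) : ℂ)) := by
    have h2 := legendreQ_sub_legendreQ h0 h1 r
    have h3 : h (-(r : ℂ)) = h r := heven r (by simp [strip]; linarith)
    have h4 : (1 / 2 + Complex.I * -(r : ℂ)) = 1 / 2 - Complex.I * r := by ring
    have h5 : (Real.tanh (Real.pi * r) : ℂ) * legendreP (-1 / 2 + Complex.I * r) (joukowski a) =
        -(Complex.I / Real.pi) * (legendreQ a (1 / 2 - Complex.I * r) -
          legendreQ a (1 / 2 + Complex.I * r)) := by
      rw [h2]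
      generalize legendreP (-1 / 2 + Complex.I * r) (joukowski a) = P
      field_simp
      linear_combination ((Real.tanh (Real.pi * r) : ℂ) * P) * Complex.I_sq
    rw [spectralFun, spectralFun, Complex.ofReal_neg, h3, h4]
    linear_combination ((r : ℂ) * h r) * h5
  simp_rw [hpt]
  rw [integral_const_mul, integral_add h_int h_int.comp_neg,
    integral_neg_eq_self (fun x : ℝ => spectralFun h a x)]
  ring

/-! ### Summation over the group -/

section Group

variable {Γ : Subgroup PSL2R} {z w : ℍ}

/-- `e^{-d(z, η w)}`. -/
noncomputable def expDist (Γ : Subgroup PSL2R) (z w : ℍ) (η : Γ) : ℝ :=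
  Real.exp (-dist z (η • w))

theorem expDist_pos (η : Γ) : 0 < expDist Γ z w η := Real.exp_pos _

theorem expDist_lt_one (hzw : proj Γ z ≠ proj Γ w) (η : Γ) : expDist Γ z w η < 1 := by
  rw [expDist, Real.exp_lt_one_iff, neg_lt_zero, dist_pos]
  intro h
  exact hzw (Quotient.sound ⟨η, h.symm⟩)

theorem joukowski_expDist (η : Γ) :
    joukowski (expDist Γ z w η) = Real.cosh (dist z (η • w)) := by
  rw [joukowski, expDist, Real.exp_neg, inv_inv, Real.cosh_eq, Real.exp_neg, add_comm]

theorem IsFuchsianFirstKind.summable_expDist_rpow (hΓ : IsFuchsianFirstKind Γ) {s : ℝ}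
    (hs : 1 < s) (z w : ℍ) : Summable fun η : Γ => expDist Γ z w η ^ s := by
  refine (hΓ.summable_cosh_rpow hs z w).of_nonneg_of_le
    (fun η => Real.rpow_nonneg (expDist_pos η).le _) fun η => ?_
  rw [Real.rpow_neg (Real.cosh_pos _).le, ← Real.inv_rpow (Real.cosh_pos _).le]
  refine Real.rpow_le_rpow (expDist_pos η).le ?_ (by linarith)
  rw [expDist, Real.exp_neg]
  have hd : 0 ≤ dist z (η • w) := dist_nonneg
  gcongr
  rw [Real.cosh_eq]
  have : Real.exp (-dist z (η • w)) ≤ Real.exp (dist z (η • w)) := Real.exp_le_exp.2 (by linarith)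
  linarith

/-- Summability leaves only finitely many `η` with `expDist` at least `1/2`, and each of those is
below `1` because `z` and `w` lie in different orbits. -/
theorem IsFuchsianFirstKind.exists_expDist_le (hΓ : IsFuchsianFirstKind Γ)
    (hzw : proj Γ z ≠ proj Γ w) : ∃ a₀, 0 < a₀ ∧ a₀ < 1 ∧ ∀ η : Γ, expDist Γ z w η ≤ a₀ := by
  have hsum := (hΓ.summable_expDist_rpow (s := 2) (by norm_num) z w).tendsto_cofinite_zero
  have hfin : {η : Γ | ¬ expDist Γ z w η ^ (2 : ℝ) < 1 / 4}.Finite :=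
    hsum.eventually (gt_mem_nhds (by norm_num : (0 : ℝ) < 1 / 4))
  have hlt (η : Γ) (hη : expDist Γ z w η ^ (2 : ℝ) < 1 / 4) : expDist Γ z w η < 1 / 2 := by
    rw [Real.rpow_two] at hη
    nlinarith [expDist_pos (Γ := Γ) (z := z) (w := w) η]
  obtain hne | hempty := hfin.toFinset.eq_empty_or_nonempty.symm
  · obtain ⟨η₁, -, hmax⟩ := hfin.toFinset.exists_max_image (expDist Γ z w) hne
    refine ⟨max (1 / 2) (expDist Γ z w η₁), by positivity,
      max_lt (by norm_num) (expDist_lt_one hzw η₁), fun η => ?_⟩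
    by_cases h : expDist Γ z w η ^ (2 : ℝ) < 1 / 4
    · exact (hlt η h).le.trans (le_max_left _ _)
    · exact (hmax η (hfin.mem_toFinset.2 h)).trans (le_max_right _ _)
  · refine ⟨1 / 2, by norm_num, by norm_num, fun η => (hlt η ?_).le⟩
    by_contra h
    have : η ∈ hfin.toFinset := hfin.mem_toFinset.2 h
    rw [hempty] at this
    simp at this

theorem norm_coshTerm (s : ℂ) (η : Γ) :
    ‖coshTerm Γ s z w η‖ = Real.cosh (dist z (η • w)) ^ (-s.re) := by
  rw [coshTerm, Complex.norm_cpow_eq_rpow_re_of_pos (Real.cosh_pos _), Complex.neg_re]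

theorem IsFuchsianFirstKind.summable_coshTerm (hΓ : IsFuchsianFirstKind Γ) {s : ℂ}
    (hs : 1 < s.re) (z w : ℍ) : Summable (coshTerm Γ s z w) := by
  refine Summable.of_norm ?_
  simp_rw [norm_coshTerm]
  exact hΓ.summable_cosh_rpow hs z w

theorem legendreQNorm_ne_zero {ν : ℂ} (hν : 0 < ν.re) : legendreQNorm ν ≠ 0 := by
  have h2 : 0 < (ν + 1 / 2).re := by simp; linarith
  refine mul_ne_zero ?_ (mul_ne_zero (div_ne_zero (Complex.Gamma_ne_zero_of_re_pos hν)
    (Complex.Gamma_ne_zero_of_re_pos h2)) (Complex.Gamma_ne_zero_of_re_pos (by norm_num)))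
  rw [Ne, Complex.cpow_eq_zero_iff]
  simp

/-- Read off from the convergence of `hasSum_legendreQ` at the point `a`, after division by its
nonzero prefactor, so no estimate of `b_k` is needed. -/
theorem summable_norm_b_div_factorial {a : ℝ} (h0 : 0 < a) (h1 : a < 1) {ν : ℂ}
    (hν : 1 ≤ ν.re) :
    Summable fun k : ℕ => ‖b k ν / k.factorial‖ * joukowski a ^ (-(2 * k : ℝ)) := by
  have hJ : 0 < joukowski a := one_pos.trans (one_lt_joukowski h0 h1)
  have hN : 0 < ‖legendreQNorm ν‖ := norm_pos_iff.2 (legendreQNorm_ne_zero (by linarith))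
  have hp : 0 < joukowski a ^ (-ν.re) := Real.rpow_pos_of_pos hJ _
  have h := (hasSum_legendreQ h0 h1 hν).summable.norm.mul_left
    (‖legendreQNorm ν‖⁻¹ * (joukowski a ^ (-ν.re))⁻¹)
  refine h.congr fun k => ?_
  have e : (-(ν + 2 * k)).re = -ν.re + -(2 * k : ℝ) := by simp; ring
  rw [norm_mul, norm_mul, Complex.norm_cpow_eq_rpow_re_of_pos hJ, e, Real.rpow_add hJ]
  field_simp

/-- Every `cosh d(z, η w)` is at least `x₀ = joukowski a₀ > 1`, so the double series is dominated by
the product of the series with terms `|b_k| / k! · x₀^{-2k}` and `cosh(d(z, η w))^{-Re ν}`. -/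
theorem IsFuchsianFirstKind.summable_b_mul_coshTerm (hΓ : IsFuchsianFirstKind Γ)
    (hzw : proj Γ z ≠ proj Γ w) {ν : ℂ} (hν : 1 < ν.re) :
    Summable fun p : ℕ × Γ => b p.1 ν / (p.1.factorial : ℂ) * coshTerm Γ (ν + 2 * p.1) z w p.2 := by
  obtain ⟨a₀, h0, h1, ha₀⟩ := hΓ.exists_expDist_le hzw
  have hJ : 0 < joukowski a₀ := one_pos.trans (one_lt_joukowski h0 h1)
  have hle (η : Γ) : joukowski a₀ ≤ Real.cosh (dist z (η • w)) := by
    rw [← joukowski_expDist, joukowski, joukowski]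
    have hp := expDist_pos (Γ := Γ) (z := z) (w := w) η
    have hl := ha₀ η
    set a := expDist Γ z w η
    have : a⁻¹ - a₀⁻¹ = (a₀ - a) / (a * a₀) := by field_simp
    have h2 : a₀ - a ≤ (a₀ - a) / (a * a₀) := by
      rw [le_div_iff₀ (by positivity)]
      have : a * a₀ ≤ 1 := by nlinarith
      nlinarith
    linarith
  refine Summable.of_norm_bounded ((summable_norm_b_div_factorial h0 h1 hν.le).mul_of_nonneg
    (hΓ.summable_cosh_rpow hν z w) (fun k => by positivity) fun η => by positivity) ?_
  rintro ⟨k, η⟩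
  have e : -(ν + 2 * k).re = -(2 * k : ℝ) + -ν.re := by simp
  have hc := Real.cosh_pos (dist z (η • w))
  rw [norm_mul, norm_coshTerm, e, Real.rpow_add hc, mul_assoc]
  gcongr ?_ * (?_ * ?_)
  exact Real.rpow_le_rpow_of_nonpos hJ (hle η) (by linarith [(k.cast_nonneg : (0 : ℝ) ≤ k)])

theorem IsFuchsianFirstKind.summable_calKTerm (hΓ : IsFuchsianFirstKind Γ)
    (hzw : proj Γ z ≠ proj Γ w) {ν : ℂ} (hν : 1 < ν.re) : Summable (calKTerm Γ ν z w) := by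
  refine (hΓ.summable_b_mul_coshTerm hzw hν).prod.congr fun k => ?_
  rw [calKTerm, coshKernel, ← tsum_mul_left]

theorem IsFuchsianFirstKind.legendreQNorm_mul_calK (hΓ : IsFuchsianFirstKind Γ)
    (hzw : proj Γ z ≠ proj Γ w) {ν : ℂ} (hν : 1 < ν.re) :
    legendreQNorm ν * calK Γ ν z w = ∑' η : Γ, legendreQ (expDist Γ z w η) ν := by
  have hS := Summable.tsum_comm (f := fun (k : ℕ) (η : Γ) =>
    b k ν / (k.factorial : ℂ) * coshTerm Γ (ν + 2 * k) z w η) (hΓ.summable_b_mul_coshTerm hzw hν)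
  have e1 : calK Γ ν z w =
      ∑' (k : ℕ) (η : Γ), b k ν / (k.factorial : ℂ) * coshTerm Γ (ν + 2 * k) z w η := by
    rw [calK]
    refine tsum_congr fun k => ?_
    rw [calKTerm, coshKernel, tsum_mul_left]
  rw [e1, ← hS, ← tsum_mul_left]
  refine tsum_congr fun η => ?_
  rw [← tsum_mul_left, ← (hasSum_legendreQ (expDist_pos η) (expDist_lt_one hzw η) hν.le).tsum_eq,
    joukowski_expDist]
  refine tsum_congr fun k => ?_
  rw [coshTerm]

/-- The factor `ν - 1/2 = ir` from `Γ(ν + 1/2) = (ν - 1/2) Γ(ν - 1/2)` supplies the `r` in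
`spectralFun`, and the leftover constant is `i / Γ(1/2)`. -/
theorem IsFuchsianFirstKind.integrand_eq (hΓ : IsFuchsianFirstKind Γ)
    (hzw : proj Γ z ≠ proj Γ w) (h : ℂ → ℂ) {ν r : ℂ} (hν : 1 < ν.re)
    (hr : ν = 1 / 2 + Complex.I * r) :
    integrand Γ h z w ν = Complex.I / Complex.Gamma (1 / 2) *
      ∑' η : Γ, spectralFun h (expDist Γ z w η) r := by
  have hG : Complex.Gamma (1 / 2) ≠ 0 := Complex.Gamma_ne_zero_of_re_pos (by norm_num)
  have hre : 0 < (ν - 1 / 2).re := by simp; linarith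
  have hG2 : Complex.Gamma (ν - 1 / 2) ≠ 0 := Complex.Gamma_ne_zero_of_re_pos hre
  have hne : ν - 1 / 2 ≠ 0 := fun h' => by rw [h'] at hre; simp at hre
  have hGa : Complex.Gamma (ν + 1 / 2) = (ν - 1 / 2) * Complex.Gamma (ν - 1 / 2) := by
    rw [← Complex.Gamma_add_one _ hne]
    congr 1
    ring
  have hrr : Complex.I * (1 / 2 - ν) = r := by
    rw [hr]
    linear_combination (-r) * Complex.I_sq
  have hIr : ν - 1 / 2 = Complex.I * r := by rw [hr]; ring
  simp only [spectralFun, ← hr]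
  rw [tsum_mul_left, ← hΓ.legendreQNorm_mul_calK hzw hν, integrand, hrr, legendreQNorm, hGa]
  have hIr0 : Complex.I * r ≠ 0 := hIr ▸ hne
  have hr0 : r ≠ 0 := right_ne_zero_of_mul hIr0
  rw [hIr] at hG2 ⊢
  field_simp

end Group

end HypKernel

/-! ### Contour shift and interchange of sum and integral -/

theorem mainTheorem10
    (Γ : Subgroup HypKernel.PSL2R) (hΓ : HypKernel.IsFuchsianFirstKind Γ)
    (k : ℝ → ℂ) (h : ℂ → ℂ) (hk : HypKernel.HasSelbergTransform k h)
    (ε : ℝ) (hε : 0 < ε)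
    (hS1 : ∀ r ∈ HypKernel.strip ε, h (-r) = h r)
    (hS2 : DifferentiableOn ℂ h (HypKernel.strip ε))
    (hbound : h =O[Bornology.cobounded ℂ ⊓ Filter.principal (HypKernel.strip ε)]
      fun r : ℂ => (1 + ‖r‖) ^ (-2 : ℤ))
    (hK : ∀ z w : UpperHalfPlane, HypKernel.proj Γ z ≠ HypKernel.proj Γ w →
      HypKernel.automorphicKernel Γ k z w = HypKernel.mehlerFockKernel Γ h z w)
    (δ : ℝ) (hδ : 0 < δ) (hδ' : δ < 1 / 2) (hδε : δ ≤ ε)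
    (z w : UpperHalfPlane) (hzw : HypKernel.proj Γ z ≠ HypKernel.proj Γ w) :
    (∀ ν : ℂ, ν.re = 1 + δ →
      (∀ j : ℕ, Summable (HypKernel.coshTerm Γ (ν + 2 * j) z w)) ∧
      Summable (HypKernel.calKTerm Γ ν z w)) ∧
    HypKernel.VerticalIntegrable (HypKernel.integrand Γ h z w) (1 + δ) ∧
    HypKernel.automorphicKernel Γ k z w =
      1 / (2 * (Real.pi : ℂ) ^ (3 / 2 : ℂ) * Complex.I) *
        HypKernel.verticalIntegral (HypKernel.integrand Γ h z w) (1 + δ) := by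
  refine ⟨fun ν hν => ⟨fun j => hΓ.summable_coshTerm ?_ z w,
    hΓ.summable_calKTerm hzw (by linarith)⟩, ?_⟩
  · have : (0 : ℝ) ≤ j := j.cast_nonneg
    simp
    linarith
  have := hΓ.discrete
  have := HypKernel.countable_of_discreteTopology Γ
  obtain ⟨C, hC0, hC⟩ := HypKernel.exists_norm_le_of_isBigO_strip hS2.continuousOn hbound
  obtain ⟨a₀, -, ha₀1, ha₀⟩ := hΓ.exists_expDist_le hzw
  obtain ⟨C', hC'0, hC'⟩ := HypKernel.exists_norm_spectralFun_le hδ hδε hC0 hC ha₀1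
  set a := HypKernel.expDist Γ z w
  have ha0 (η : Γ) : 0 < a η := HypKernel.expDist_pos η
  have ha1 (η : Γ) : a η < 1 := HypKernel.expDist_lt_one hzw η
  -- On the line `r = t + ic` one has `1/2 + ir = 1 + δ + it`, the target line.
  let c : ℝ := -(1 / 2 + δ)
  have hc : c ∈ Set.Icc (-(1 / 2 + δ)) 0 := ⟨le_rfl, by simp only [c]; linarith⟩
  let F : Γ → ℝ → ℂ := fun η t => HypKernel.spectralFun h (a η) (t + c * Complex.I)
  have hFc (η : Γ) : Continuous (F η) :=
    HypKernel.continuous_spectralFun_line hS2 hδ hδε (ha0 η) (ha1 η) hc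
  have hFb (η : Γ) (t : ℝ) : ‖F η t‖ ≤ C' * a η ^ (1 + δ) * (1 + |t|) ^ (-(3 / 2) : ℝ) := by
    have := hC' (a η) (ha0 η) (ha₀ η) (t + c * Complex.I) (by simpa using hc)
    have e : (1 / 2 - (t + c * Complex.I : ℂ).im) = 1 + δ := by simp [c]; ring
    rw [e] at this
    simpa using this
  have hsum : Summable fun η : Γ => C' * a η ^ (1 + δ) :=
    (hΓ.summable_expDist_rpow (by linarith) z w).mul_left C'
  have hone (t : ℝ) : (1 + |t|) ^ (-(3 / 2) : ℝ) ≤ 1 :=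
    Real.rpow_le_one_of_one_le_of_nonpos (by linarith [abs_nonneg t]) (by norm_num)
  have hcoef (η : Γ) : 0 ≤ C' * a η ^ (1 + δ) :=
    mul_nonneg hC'0 (Real.rpow_nonneg (ha0 η).le _)
  have hSc : Continuous fun t => ∑' η, F η t :=
    continuous_tsum hFc hsum fun η t => (hFb η t).trans (mul_le_of_le_one_right (hcoef η) (hone t))
  have hSb (t : ℝ) : ‖∑' η, F η t‖ ≤ (∑' η, C' * a η ^ (1 + δ)) * (1 + |t|) ^ (-(3 / 2) : ℝ) :=
    tsum_of_norm_bounded (hsum.hasSum.mul_right _) fun η => hFb η t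
  have hSi : MeasureTheory.Integrable fun t => ∑' η, F η t :=
    (HypKernel.integrable_one_add_abs_rpow.const_mul _).mono' hSc.aestronglyMeasurable
      (Filter.Eventually.of_forall hSb)
  have h_int (t : ℝ) : HypKernel.integrand Γ h z w (((1 + δ : ℝ) : ℂ) + t * Complex.I) =
      Complex.I / Complex.Gamma (1 / 2) * ∑' η, F η t := by
    refine hΓ.integrand_eq hzw h (by simpa using hδ) ?_
    simp only [c]
    push_cast
    linear_combination (1 / 2 + δ : ℂ) * Complex.I_sq
  -- The interchange is possible only after the shift: the bound carries `a^{1+δ}`, summable over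
  -- `Γ`, in place of the `a^{1/2}` of the real line.
  have hsw : HasSum (fun η => ∫ t, F η t) (∫ t, ∑' η, F η t) := by
    refine MeasureTheory.hasSum_integral_of_dominated_convergence
      (fun η t => C' * a η ^ (1 + δ) * (1 + |t|) ^ (-(3 / 2) : ℝ))
      (fun η => (hFc η).aestronglyMeasurable) (fun η => Filter.Eventually.of_forall (hFb η))
      (Filter.Eventually.of_forall fun t => hsum.mul_right _) ?_
      (Filter.Eventually.of_forall fun t => ?_)
    · simp_rw [tsum_mul_right]
      exact HypKernel.integrable_one_add_abs_rpow.const_mul _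
    · exact (Summable.of_norm_bounded (hsum.mul_right _) fun η => hFb η t).hasSum
  refine ⟨?_, ?_⟩
  · unfold HypKernel.VerticalIntegrable
    simp_rw [h_int]
    exact hSi.const_mul _
  · rw [hK z w hzw, HypKernel.mehlerFockKernel, HypKernel.verticalIntegral]
    simp_rw [h_int]
    rw [MeasureTheory.integral_const_mul, ← hsw.tsum_eq]
    have hterm (η : Γ) : ∫ r : ℝ, (r * Real.tanh (Real.pi * r) : ℂ) * h r *
        HypKernel.legendreP (-1 / 2 + Complex.I * r) (Real.cosh (dist z (η • w))) =
        2 * Complex.I / Real.pi * ∫ t, F η t := by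
      rw [← HypKernel.joukowski_expDist, HypKernel.integral_legendreP_eq hS1 hS2 hδ hδε (ha0 η)
        (ha1 η) hC0 hC, ← HypKernel.integral_spectralFun_shift hS2 hδ hδε (ha0 η) (ha1 η) hC0 hC]
    simp_rw [hterm]
    rw [tsum_mul_left]
    have hpi : (Real.pi : ℂ) ≠ 0 := by exact_mod_cast Real.pi_ne_zero
    have hG : Complex.Gamma (1 / 2) = (Real.pi : ℂ) ^ (1 / 2 : ℂ) := Complex.Gamma_one_half_eq
    have hp : (Real.pi : ℂ) ^ (3 / 2 : ℂ) * (Real.pi : ℂ) ^ (1 / 2 : ℂ) = (Real.pi : ℂ) ^ 2 := by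
      rw [← Complex.cpow_add _ _ hpi, ← Complex.cpow_natCast]
      norm_num
    have hq : (Real.pi : ℂ) ^ (3 / 2 : ℂ) ≠ 0 := by simp [Complex.cpow_eq_zero_iff, hpi]
    have hq2 : (Real.pi : ℂ) ^ (1 / 2 : ℂ) ≠ 0 := by simp [Complex.cpow_eq_zero_iff, hpi]
    rw [hG]
    generalize ∑' η : Γ, ∫ t, F η t = S
    generalize (Real.pi : ℂ) ^ (3 / 2 : ℂ) = A at *
    generalize (Real.pi : ℂ) ^ (1 / 2 : ℂ) = B at *
    -- Both constants equal `i / (2π²)`: `(1/(4π)) (2i/π)` on the left, and `i / (2 π^{3/2}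
    -- π^{1/2})` on the right.
    field_simp
    linear_combination (4 * S : ℂ) * hp
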